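/- Let $L:L^2(0,\infty)\to L^2(0,\infty)$, $(Lf)(z)=\int_0^\infty e^{-z\tau}f(\tau)\,d\tau$, be the real Laplace transform, and let $V:L^2(0,\infty)\to L^2(\mathbb R)$, $(Vf)(u)=e^{u/2}f(e^u)$. Let $\widehat\varphi(\xi)=\frac1{\sqrt{2\pi}}\int_{\mathbb R}e^{-i\xi t}\varphi(t)\,dt$. Let $s>0$ and let $\varphi\in L^1(\mathbb R)$ be real-valued with $\int\varphi=1$ and $\widehat\varphi$ real-valued, such that $\widehat\varphi(\xi)<1/\sqrt{2\pi}$ for all $\xi\ne0$, $\widehat\varphi(\xi)$ is nonincreasing in $|\xi|$, and $|1-\sqrt{2\pi}\,\widehat\varphi(\xi)|\sim|\xi|^s$ as $\xi\to0$. For $\beta>0$ put $\varphi_\beta(t)=\frac1\beta\varphi(t/\beta)$ and $C_\beta w=\varphi_\beta*w$ on $L^2(\mathbb R)$. Let $p>0$, $f_p(t)=(-\ln t)^{-p}$ for $t\in(0,1)$ (with $f_p(0)=0$), and let $\Theta_p(t)=\sqrt t\,f_p(t)$, an increasing bijection from $(0,1)$ onto $(0,\infty)$. Put $\overline L=L/\sqrt{\pi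 e}$ and let $f_p(\overline L^*\overline L)$ be defined by the functional calculus. All norms without index are $L^2$-norms, and $\|w\|_{H^p}^2=\int_{\mathbb R}(1+\xi^2)^p|\widehat w(\xi)|^2\,d\xi$. Then: 1. For all $\beta>0$ and $\gamma\in L^2(0,\infty)$, the functional $h\mapsto\|\gamma-Lh\|^2+\|(I-C_\beta)Vh\|^2$ has exactly one minimizer in $L^2(0,\infty)$. For noisy data $\gamma=g^\delta$ it is denoted $f_\beta^\delta$. 2. There are constants $C^{(1)},C^{(2)}>0$ such that every $f\in L^2(0,\infty)$ with $Vf\in H^p(\mathbb R)$ can be written as $f=f_p(\overline L^*\overline L)w$ with a unique $w\in L^2(0,\infty)$, and $C^{(1)}\|w\|\le\|Vf\|_{H^p}\le C^{(2)}\|w\|$. 3. There is a constant $K>0$ such that for every $\rho>0$ the following holds. If $f\in L^2(0,\infty)$ satisfies $Vf\in H^p(\mathbb R)$ and $\|w\|=\rho$ for the $w$ of part 2, if $g=Lf$, and if $g^\delta\in L^2(0,\infty)$ satisfies $\|g-g^\delta\|\le\delta$, then for the a priori rule $\beta(\delta)=\big(\Theta_p^{-1}(\delta/\rho)\big)^{1/(2s)}$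 $$\|f-f^\delta_{\beta(\delta)}\|\le K\,\rho\,f_p(\delta^2/\rho^2)\,(1+o(1))\qquad(\delta\downarrow0).$$ Here $K$ does not depend on $\rho$, $\delta$, $f$ or $g^\delta$, and for fixed $\rho$ the $o(1)$ is uniform in $f$ and $g^\delta$. 4. This rate is order-optimal: there is $c>0$ such that for every $\rho>0$, all sufficiently small $\delta>0$ and every map $R:L^2(0,\infty)\to L^2(0,\infty)$ there are $f=f_p(\overline L^*\overline L)w$ with $Vf\in H^p(\mathbb R)$, $\|w\|=\rho$, and $g^\delta\in L^2(0,\infty)$ with $\|Lf-g^\delta\|\le\delta$ such that $\|f-R(g^\delta)\|\ge c\,\rho\,f_p(\delta^2/\rho^2)$. -/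

import Mathlib

open MeasureTheory Set Filter Topology
open scoped ENNReal NNReal FourierTransform SchwartzMap

noncomputable section

namespace RealLaplace

/-! ### Integral operators on `L²` -/

section KernelOperators

variable {X Y : Type*} [MeasurableSpace X] [MeasurableSpace Y]

/-- The kernel `k` defines an (absolutely convergent) bounded integral operator
`L²(ν) → L²(μ)`. -/
structure BoundedKernel (μ : Measure X) (ν : Measure Y) (k : X → Y → ℂ) : Prop where
  aesm : AEStronglyMeasurable (Function.uncurry k) (μ.prod ν)
  bound : ∃ C : ℝ≥0, ∀ f : Y → ℂ, AEStronglyMeasurable f ν →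
    ∫⁻ x, (∫⁻ y, ‖k x y * f y‖ₑ ∂ν) ^ 2 ∂μ ≤ (C : ℝ≥0∞) ^ 2 * ∫⁻ y, ‖f y‖ₑ ^ 2 ∂ν

theorem eLpNorm_two_sq {Z : Type*} [MeasurableSpace Z] (μ : Measure Z) (f : Z → ℂ) :
    eLpNorm f 2 μ ^ 2 = ∫⁻ x, ‖f x‖ₑ ^ 2 ∂μ := by
  have h := eLpNorm_nnreal_pow_eq_lintegral (μ := μ) (f := f) (p := 2) (by norm_num)
  simpa using h

/-- Schur's test. -/
theorem boundedKernel_of_weights {μ : Measure X} {ν : Measure Y} [SFinite μ] [SFinite ν]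
    {k : X → Y → ℂ} (hk : AEStronglyMeasurable (Function.uncurry k) (μ.prod ν))
    (p : X → ℝ≥0∞) (q : Y → ℝ≥0∞) (hp : Measurable p) (hq : Measurable q)
    (hq0 : ∀ᵐ y ∂ν, q y ≠ 0) (hqt : ∀ᵐ y ∂ν, q y ≠ ∞) (C : ℝ≥0)
    (hrow : ∀ᵐ x ∂μ, ∫⁻ y, ‖k x y‖ₑ * q y ∂ν ≤ C * p x)
    (hcol : ∀ᵐ y ∂ν, ∫⁻ x, p x * ‖k x y‖ₑ ∂μ ≤ C * q y) :
    BoundedKernel μ ν k := by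
  refine ⟨hk, C, fun f hf => ?_⟩
  have hkm : AEMeasurable (fun z : X × Y => ‖k z.1 z.2‖ₑ) (μ.prod ν) := hk.enorm
  have hkx : ∀ᵐ x ∂μ, AEMeasurable (fun y => ‖k x y‖ₑ) ν := by
    filter_upwards [hk.prodMk_left] with x hx using hx.enorm
  have hgm : AEMeasurable (fun y => ‖f y‖ₑ ^ 2 * (q y)⁻¹) ν :=
    (hf.enorm.pow_const 2).mul hq.inv.aemeasurable
  have key : ∀ᵐ x ∂μ, (∫⁻ y, ‖k x y * f y‖ₑ ∂ν) ^ 2 ≤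
      C * ∫⁻ y, p x * ‖k x y‖ₑ * (‖f y‖ₑ ^ 2 * (q y)⁻¹) ∂ν := by
    filter_upwards [hkx, hrow] with x hx hrx
    have h1 : ∫⁻ y, ‖k x y * f y‖ₑ ∂ν ≤
        (∫⁻ y, ‖k x y‖ₑ * q y ∂ν) ^ (1 / 2 : ℝ) *
          (∫⁻ y, ‖k x y‖ₑ * (‖f y‖ₑ ^ 2 * (q y)⁻¹) ∂ν) ^ (1 / 2 : ℝ) := by
      refine le_trans (lintegral_mono_ae ?_)
        (ENNReal.lintegral_mul_norm_pow_le (hx.mul hq.aemeasurable) (hx.mul hgm)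
          (p := 1 / 2) (q := 1 / 2) (by norm_num) (by norm_num) (by norm_num))
      filter_upwards [hq0, hqt] with y h0 ht
      rw [← ENNReal.mul_rpow_of_nonneg _ _ (by norm_num), enorm_mul]
      have : ‖k x y‖ₑ * q y * (‖k x y‖ₑ * (‖f y‖ₑ ^ 2 * (q y)⁻¹)) =
          (‖k x y‖ₑ * ‖f y‖ₑ) ^ (2 : ℝ) := by
        rw [ENNReal.rpow_two]
        calc _ = (‖k x y‖ₑ * ‖f y‖ₑ) ^ 2 * (q y * (q y)⁻¹) := by ring
          _ = _ := by rw [ENNReal.mul_inv_cancel h0 ht, mul_one]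
      simp only [Pi.mul_apply]
      rw [this, ← ENNReal.rpow_mul]
      norm_num
    have h2 : (∫⁻ y, ‖k x y * f y‖ₑ ∂ν) ^ 2 ≤
        (∫⁻ y, ‖k x y‖ₑ * q y ∂ν) * ∫⁻ y, ‖k x y‖ₑ * (‖f y‖ₑ ^ 2 * (q y)⁻¹) ∂ν := by
      refine (pow_le_pow_left₀ (zero_le (a := _)) h1 2).trans (le_of_eq ?_)
      rw [← ENNReal.mul_rpow_of_nonneg _ _ (by norm_num), ← ENNReal.rpow_two,
        ← ENNReal.rpow_mul]
      norm_num
    refine h2.trans ((mul_le_mul_left hrx _).trans (le_of_eq ?_))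
    have e := lintegral_const_mul'' (p x) (hx.mul hgm)
    simp only [Pi.mul_apply] at e
    rw [mul_assoc, ← e]
    simp only [mul_assoc]
  refine (lintegral_mono_ae key).trans ?_
  have hF : AEMeasurable (Function.uncurry fun (x : X) (y : Y) =>
      p x * ‖k x y‖ₑ * (‖f y‖ₑ ^ 2 * (q y)⁻¹)) (μ.prod ν) :=
    ((hp.comp measurable_fst).aemeasurable.mul hkm).mul hgm.comp_snd
  rw [lintegral_const_mul'' _ hF.lintegral_prod_right, lintegral_lintegral_swap hF]
  have hcol' : ∀ᵐ y ∂ν, ∫⁻ x, p x * ‖k x y‖ₑ * (‖f y‖ₑ ^ 2 * (q y)⁻¹) ∂μ ≤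
      C * ‖f y‖ₑ ^ 2 := by
    have hky : ∀ᵐ y ∂ν, AEMeasurable (fun x => ‖k x y‖ₑ) μ := by
      filter_upwards [hk.prod_swap.prodMk_left] with y hy using hy.enorm
    filter_upwards [hcol, hq0, hqt, hky] with y hy h0 ht hym
    have e := lintegral_mul_const'' (‖f y‖ₑ ^ 2 * (q y)⁻¹) (hp.aemeasurable.mul hym)
    simp only [Pi.mul_apply] at e
    rw [e]
    refine (mul_le_mul_left hy _).trans (le_of_eq ?_)
    calc _ = C * ‖f y‖ₑ ^ 2 * (q y * (q y)⁻¹) := by ring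
      _ = _ := by rw [ENNReal.mul_inv_cancel h0 ht, mul_one]
  calc _ ≤ (C : ℝ≥0∞) * ∫⁻ y, C * ‖f y‖ₑ ^ 2 ∂ν := by
        exact mul_le_mul_right (lintegral_mono_ae hcol') _
    _ = _ := by
      rw [lintegral_const_mul'' _ (hf.enorm.pow_const 2)]; ring

variable {μ : Measure X} {ν : Measure Y} {k : X → Y → ℂ}

theorem BoundedKernel.lintegral_lt_top (hk : BoundedKernel μ ν k) {f : Y → ℂ}
    (hf : MemLp f 2 ν) : ∫⁻ x, (∫⁻ y, ‖k x y * f y‖ₑ ∂ν) ^ 2 ∂μ < ∞ := by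
  obtain ⟨C, hC⟩ := hk.bound
  refine (hC f hf.1).trans_lt ?_
  rw [← eLpNorm_two_sq]
  exact ENNReal.mul_lt_top (by simp) (ENNReal.pow_lt_top hf.2)

theorem BoundedKernel.aesm_mul (hk : BoundedKernel μ ν k) {f : Y → ℂ}
    (hf : MemLp f 2 ν) :
    AEStronglyMeasurable (fun z : X × Y => k z.1 z.2 * f z.2) (μ.prod ν) :=
  hk.aesm.mul hf.1.comp_snd

theorem BoundedKernel.integrable [SFinite ν] (hk : BoundedKernel μ ν k) {f : Y → ℂ}
    (hf : MemLp f 2 ν) : ∀ᵐ x ∂μ, Integrable (fun y => k x y * f y) ν := by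
  have hm : AEMeasurable (fun x => (∫⁻ y, ‖k x y * f y‖ₑ ∂ν) ^ 2) μ :=
    (AEMeasurable.lintegral_prod_right (f := fun x y => ‖k x y * f y‖ₑ)
      (hk.aesm_mul hf).enorm).pow_const 2
  filter_upwards [ae_lt_top' hm (hk.lintegral_lt_top hf).ne,
    (hk.aesm_mul hf).prodMk_left] with x hx hx'
  refine ⟨hx', ?_⟩
  by_contra h
  have : ∫⁻ y, ‖k x y * f y‖ₑ ∂ν = ∞ := by
    simpa [HasFiniteIntegral] using h
  rw [this] at hx
  exact absurd hx (by simp)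

theorem BoundedKernel.memLp [SFinite ν] (hk : BoundedKernel μ ν k) {f : Y → ℂ}
    (hf : MemLp f 2 ν) : MemLp (fun x => ∫ y, k x y * f y ∂ν) 2 μ := by
  refine ⟨(hk.aesm_mul hf).integral_prod_right', ?_⟩
  have : eLpNorm (fun x => ∫ y, k x y * f y ∂ν) 2 μ ^ 2 < ∞ := by
    rw [eLpNorm_two_sq]
    refine (lintegral_mono fun x => ?_).trans_lt (hk.lintegral_lt_top hf)
    gcongr
    exact enorm_integral_le_lintegral_enorm _
  simpa using this

/-- The operator `f ↦ (x ↦ ∫ k(x, y) f(y) dν(y))` from `L²(ν)` to `L²(μ)`. -/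
def kernelOp [SFinite ν] (hk : BoundedKernel μ ν k) : Lp ℂ 2 ν →L[ℂ] Lp ℂ 2 μ :=
  LinearMap.mkContinuousOfExistsBound
    { toFun := fun f => (hk.memLp (Lp.memLp f)).toLp (fun x => ∫ y, k x y * f y ∂ν)
      map_add' := by
        intro f g
        rw [← MemLp.toLp_add, MemLp.toLp_eq_toLp_iff]
        filter_upwards [hk.integrable (Lp.memLp f), hk.integrable (Lp.memLp g)] with x hf hg
        rw [Pi.add_apply, ← integral_add hf hg]
        refine integral_congr_ae ?_
        filter_upwards [Lp.coeFn_add f g] with y hy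
        rw [hy, Pi.add_apply, mul_add]
      map_smul' := by
        intro c f
        rw [RingHom.id_apply, ← MemLp.toLp_const_smul, MemLp.toLp_eq_toLp_iff]
        filter_upwards with x
        rw [Pi.smul_apply, ← integral_smul]
        refine integral_congr_ae ?_
        filter_upwards [Lp.coeFn_smul c f] with y hy
        rw [hy, Pi.smul_apply, smul_eq_mul, smul_eq_mul]
        ring }
    (by
      obtain ⟨C, hC⟩ := hk.bound
      refine ⟨C, fun f => ?_⟩
      have h1 : eLpNorm (fun x => ∫ y, k x y * f y ∂ν) 2 μ ≤ C * eLpNorm f 2 ν := by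
        rw [← ENNReal.pow_le_pow_left_iff two_ne_zero, mul_pow, eLpNorm_two_sq, eLpNorm_two_sq]
        refine (lintegral_mono fun x => ?_).trans (hC f (Lp.aestronglyMeasurable f))
        gcongr
        exact enorm_integral_le_lintegral_enorm _
      have h2 := ENNReal.toReal_mono
        (ENNReal.mul_ne_top ENNReal.coe_ne_top (Lp.eLpNorm_ne_top f)) h1
      simp only [LinearMap.coe_mk, AddHom.coe_mk, Lp.norm_toLp]
      rwa [ENNReal.toReal_mul, ENNReal.coe_toReal, ← Lp.norm_def] at h2)

theorem kernelOp_apply [SFinite ν] (hk : BoundedKernel μ ν k) (f : Lp ℂ 2 ν) :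
    kernelOp hk f =ᵐ[μ] fun x => ∫ y, k x y * f y ∂ν :=
  MemLp.coeFn_toLp (hk.memLp (Lp.memLp f))

end KernelOperators

/-! ### The operators `L`, `V` and `C_β` -/

/-- `L²(0,∞)`. -/
abbrev L2pos : Type := Lp ℂ 2 ((volume : Measure ℝ).restrict (Ioi 0))

/-- `L²(ℝ)`. -/
abbrev L2line : Type := Lp ℂ 2 (volume : Measure ℝ)

theorem lintegral_exp_rpow {a : ℝ} (ha : 0 < a) :
    ∫⁻ t in Ioi (0 : ℝ), ENNReal.ofReal (Real.exp (-(a * t))) *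
      ENNReal.ofReal (t ^ (-(1 / 2) : ℝ)) =
      ENNReal.ofReal √Real.pi * ENNReal.ofReal (a ^ (-(1 / 2) : ℝ)) := by
  have h := Real.integral_rpow_mul_exp_neg_mul_Ioi (a := 1 / 2) (r := a) (by norm_num) ha
  have hpos : 0 < ∫ t in Ioi (0 : ℝ), t ^ ((1 / 2 : ℝ) - 1) * Real.exp (-(a * t)) := by
    rw [h]
    exact mul_pos (by positivity) (Real.Gamma_pos_of_pos (by norm_num))
  have hi : IntegrableOn (fun t : ℝ => t ^ ((1 / 2 : ℝ) - 1) * Real.exp (-(a * t))) (Ioi 0) := by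
    by_contra hc
    rw [integral_undef hc] at hpos
    exact lt_irrefl _ hpos
  have h2 := ofReal_integral_eq_lintegral_ofReal hi
    ((ae_restrict_iff' measurableSet_Ioi).2 (Eventually.of_forall fun t (ht : 0 < t) => by
      simp only [Pi.zero_apply]; positivity))
  rw [h, Real.Gamma_one_half_eq] at h2
  rw [← ENNReal.ofReal_mul (by positivity)]
  have e : √Real.pi * a ^ (-(1 / 2) : ℝ) = (1 / a) ^ (1 / 2 : ℝ) * √Real.pi := by
    rw [one_div a, Real.inv_rpow ha.le, Real.rpow_neg ha.le, mul_comm]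
  rw [e, h2]
  refine lintegral_congr fun t => ?_
  rw [← ENNReal.ofReal_mul (Real.exp_pos _).le, mul_comm]
  norm_num

theorem laplace_boundedKernel :
    BoundedKernel ((volume : Measure ℝ).restrict (Ioi 0)) ((volume : Measure ℝ).restrict (Ioi 0))
      (fun z τ : ℝ => Complex.exp (-((z : ℂ) * τ))) := by
  have hn : ∀ z τ : ℝ, ‖Complex.exp (-((z : ℂ) * τ))‖ₑ = ENNReal.ofReal (Real.exp (-(z * τ))) := by
    intro z τ
    rw [← ofReal_norm, Complex.norm_exp]
    simp
  have hw : Measurable fun t : ℝ => ENNReal.ofReal (t ^ (-(1 / 2) : ℝ)) := by fun_prop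
  refine boundedKernel_of_weights ?_ (fun t => ENNReal.ofReal (t ^ (-(1 / 2) : ℝ)))
    (fun t => ENNReal.ofReal (t ^ (-(1 / 2) : ℝ))) hw hw ?_ ?_ (Real.toNNReal √Real.pi) ?_ ?_
  · exact (by unfold Function.uncurry; fun_prop :
      Continuous (Function.uncurry fun z τ : ℝ =>
        Complex.exp (-((z : ℂ) * τ)))).aestronglyMeasurable
  · refine (ae_restrict_iff' measurableSet_Ioi).2 (Eventually.of_forall fun t (ht : 0 < t) => ?_)
    simpa using Real.rpow_pos_of_pos ht _
  · exact Eventually.of_forall fun t => ENNReal.ofReal_ne_top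
  · refine (ae_restrict_iff' measurableSet_Ioi).2 (Eventually.of_forall fun z (hz : 0 < z) => ?_)
    simp only [hn]
    exact (lintegral_exp_rpow hz).le
  · refine (ae_restrict_iff' measurableSet_Ioi).2 (Eventually.of_forall fun τ (hτ : 0 < τ) => ?_)
    simp only [hn]
    refine le_of_eq ((lintegral_congr fun z => ?_).trans (lintegral_exp_rpow hτ))
    rw [mul_comm, mul_comm z τ]

/-- The real Laplace transform on `L²(0,∞)`: `(L f)(z) = ∫₀^∞ e^{-zτ} f(τ) dτ`. -/
def laplaceOp : L2pos →L[ℂ] L2pos :=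
  kernelOp laplace_boundedKernel

/-- The dilated kernel `φ_β(t) = φ(t/β)/β`. -/
def dilate (φ : ℝ → ℝ) (β : ℝ) (t : ℝ) : ℝ := (1 / β) * φ (t / β)

theorem integrable_dilate {φ : ℝ → ℝ} (hφ : Integrable φ) (β : ℝ) :
    Integrable (dilate φ β) := by
  rcases eq_or_ne β 0 with rfl | hβ
  · have : dilate φ 0 = fun _ => 0 := by funext t; simp [dilate]
    rw [this]
    exact integrable_zero _ _ _
  · exact (hφ.comp_div hβ).const_mul (1 / β)

theorem convolution_boundedKernel {ψ : ℝ → ℝ} (hψ : Integrable ψ) :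
    BoundedKernel (volume : Measure ℝ) (volume : Measure ℝ)
      (fun x t : ℝ => ((ψ (x - t) : ℝ) : ℂ)) := by
  have hn : ∀ x : ℝ, ‖((x : ℝ) : ℂ)‖ₑ = ‖x‖ₑ := fun x => by
    rw [← ofReal_norm, ← ofReal_norm, Complex.norm_real]
  refine boundedKernel_of_weights ?_ (fun _ => 1) (fun _ => 1) measurable_const measurable_const
    (by simp) (by simp) (∫⁻ t, ‖ψ t‖ₑ).toNNReal ?_ ?_
  · exact Complex.continuous_ofReal.comp_aestronglyMeasurable
      (hψ.1.comp_quasiMeasurePreserving (quasiMeasurePreserving_sub volume volume))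
  · refine Eventually.of_forall fun x => ?_
    simp only [hn, mul_one]
    rw [ENNReal.coe_toNNReal hψ.2.ne, lintegral_sub_left_eq_self (fun t => ‖ψ t‖ₑ) x]
  · refine Eventually.of_forall fun t => ?_
    simp only [hn, mul_one, one_mul]
    rw [ENNReal.coe_toNNReal hψ.2.ne, lintegral_sub_right_eq_self (fun x => ‖ψ x‖ₑ) t]

/-- The convolution operator `C_β w = φ_β * w` on `L²(ℝ)`. -/
def mollifyOp {φ : ℝ → ℝ} (hφ : Integrable φ) (β : ℝ) : L2line →L[ℂ] L2line :=
  kernelOp (convolution_boundedKernel (integrable_dilate hφ β))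

theorem lintegral_comp_exp (G : ℝ → ℝ≥0∞) :
    ∫⁻ u : ℝ, ENNReal.ofReal (Real.exp u) * G (Real.exp u) = ∫⁻ x in Ioi (0 : ℝ), G x := by
  have h := lintegral_image_eq_lintegral_abs_deriv_mul (s := univ) (f := Real.exp)
    (f' := Real.exp) MeasurableSet.univ (fun x _ => (Real.hasDerivAt_exp x).hasDerivWithinAt)
    Real.exp_injective.injOn G
  rw [image_univ, Real.range_exp, Measure.restrict_univ] at h
  rw [h]
  simp only [abs_of_pos (Real.exp_pos _)]

theorem quasiMeasurePreserving_exp :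
    Measure.QuasiMeasurePreserving Real.exp (volume : Measure ℝ)
      ((volume : Measure ℝ).restrict (Ioi 0)) := by
  refine ⟨Real.measurable_exp, Measure.AbsolutelyContinuous.mk fun s hs h0 => ?_⟩
  rw [Measure.map_apply Real.measurable_exp hs]
  have h := lintegral_comp_exp (s.indicator 1)
  rw [lintegral_indicator_one hs, h0, lintegral_eq_zero_iff (by
    have : Measurable (s.indicator (1 : ℝ → ℝ≥0∞)) := measurable_one.indicator hs
    fun_prop)] at h
  refine measure_mono_null ?_ (ae_iff.1 h)
  intro u hu hc
  have hu' : Real.exp u ∈ s := hu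
  simp [hu', (Real.exp_pos u).not_ge] at hc

theorem vTransform_lintegral (f : ℝ → ℂ) :
    ∫⁻ u : ℝ, ‖(Real.exp (u / 2) : ℂ) * f (Real.exp u)‖ₑ ^ 2 =
      ∫⁻ x in Ioi (0 : ℝ), ‖f x‖ₑ ^ 2 := by
  rw [← lintegral_comp_exp]
  refine lintegral_congr fun u => ?_
  rw [enorm_mul, mul_pow]
  congr 1
  rw [← ofReal_norm, Complex.norm_real, Real.norm_of_nonneg (Real.exp_pos _).le,
    ← ENNReal.ofReal_pow (Real.exp_pos _).le, ← Real.exp_nat_mul]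
  congr 2
  push_cast
  ring

theorem vTransform_memLp (f : L2pos) :
    MemLp (fun u : ℝ => (Real.exp (u / 2) : ℂ) * f (Real.exp u)) 2 volume := by
  refine ⟨?_, ?_⟩
  · refine AEStronglyMeasurable.mul ?_
      ((Lp.aestronglyMeasurable f).comp_quasiMeasurePreserving quasiMeasurePreserving_exp)
    exact (by fun_prop : Continuous fun u : ℝ =>
      (Real.exp (u / 2) : ℂ)).aestronglyMeasurable
  · have : eLpNorm (fun u : ℝ => (Real.exp (u / 2) : ℂ) * f (Real.exp u)) 2 volume ^ 2 < ∞ := by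
      rw [eLpNorm_two_sq, vTransform_lintegral, ← eLpNorm_two_sq]
      exact ENNReal.pow_lt_top (Lp.memLp f).2
    simpa using this

/-- The isometry `V : L²(0,∞) → L²(ℝ)`, `(V f)(u) = e^{u/2} f(e^u)`. -/
def vTransform : L2pos →ₗᵢ[ℂ] L2line where
  toFun f := (vTransform_memLp f).toLp _
  map_add' := by
    intro f g
    rw [← MemLp.toLp_add, MemLp.toLp_eq_toLp_iff]
    filter_upwards [quasiMeasurePreserving_exp.ae (Lp.coeFn_add f g)] with u hu
    rw [hu, Pi.add_apply, Pi.add_apply, mul_add]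
  map_smul' := by
    intro c f
    rw [RingHom.id_apply, ← MemLp.toLp_const_smul, MemLp.toLp_eq_toLp_iff]
    filter_upwards [quasiMeasurePreserving_exp.ae (Lp.coeFn_smul c f)] with u hu
    rw [hu, Pi.smul_apply, Pi.smul_apply, smul_eq_mul, smul_eq_mul]
    ring
  norm_map' := by
    intro f
    simp only [LinearMap.coe_mk, AddHom.coe_mk]
    rw [Lp.norm_toLp, Lp.norm_def]
    congr 1
    have h : eLpNorm (fun u : ℝ => (Real.exp (u / 2) : ℂ) * f (Real.exp u)) 2 volume ^ 2 =
        eLpNorm f 2 ((volume : Measure ℝ).restrict (Ioi 0)) ^ 2 := by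
      rw [eLpNorm_two_sq, eLpNorm_two_sq, vTransform_lintegral]
    exact le_antisymm ((ENNReal.pow_le_pow_left_iff two_ne_zero).1 h.le)
      ((ENNReal.pow_le_pow_left_iff two_ne_zero).1 h.ge)

theorem vTransform_apply (f : L2pos) :
    vTransform f =ᵐ[volume] fun u : ℝ => (Real.exp (u / 2) : ℂ) * f (Real.exp u) :=
  MemLp.coeFn_toLp (vTransform_memLp f)

/-! ### Mollifiers and the mollified solution -/

/-- The Fourier transform `φ̂(ξ) = (2π)^{-1/2} ∫ e^{-iξt} φ(t) dt`. -/
def fourierHat (φ : ℝ → ℝ) (ξ : ℝ) : ℂ :=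
  ((1 / √(2 * Real.pi) : ℝ) : ℂ) * ∫ t : ℝ, Complex.exp (-(Complex.I * ξ * t)) * (φ t : ℂ)

/-- Assumptions on the mollifier: `φ ∈ L¹(ℝ)` has unit integral, `φ̂` is real-valued,
`φ̂(ξ) < 1/√(2π)` for `ξ ≠ 0`, `φ̂(ξ)` is nonincreasing in `|ξ|`, and
`|1 - √(2π) φ̂(ξ)| ∼ |ξ|^s` as `ξ → 0`. -/
structure IsMollifier (φ : ℝ → ℝ) (s : ℝ) : Prop where
  integrable : Integrable φ
  integral_eq_one : ∫ t, φ t = 1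
  fourier_real : ∀ ξ, (fourierHat φ ξ).im = 0
  fourier_lt : ∀ ξ, ξ ≠ 0 → (fourierHat φ ξ).re < 1 / √(2 * Real.pi)
  fourier_anti : ∀ ξ η : ℝ, |ξ| ≤ |η| → (fourierHat φ η).re ≤ (fourierHat φ ξ).re
  fourier_equiv : Asymptotics.IsEquivalent (𝓝[≠] (0 : ℝ))
    (fun ξ => ‖1 - (√(2 * Real.pi) : ℂ) * fourierHat φ ξ‖) (fun ξ => |ξ| ^ s)

/-- The objective `h ↦ ‖γ - L h‖² + ‖(I - C_β) V h‖²`. -/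
def mollObjective {φ : ℝ → ℝ} (hφ : Integrable φ) (β : ℝ) (γ h : L2pos) : ℝ :=
  ‖γ - laplaceOp h‖ ^ 2 + ‖vTransform h - mollifyOp hφ β (vTransform h)‖ ^ 2

/-- `h` is a mollified (regularized) solution for the data `γ`: it minimizes the objective over
`L²(0,∞)`. -/
def IsMollifiedSolution {φ : ℝ → ℝ} (hφ : Integrable φ) (β : ℝ) (γ h : L2pos) : Prop :=
  ∀ h' : L2pos, mollObjective hφ β γ h ≤ mollObjective hφ β γ h'

/-! ### Smoothness and the logarithmic source condition -/

/-- `w ∈ H^p(ℝ)`. -/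
def MemHp (p : ℝ) (w : L2line) : Prop :=
  TemperedDistribution.MemSobolev p 2 (w : 𝓢'(ℝ, ℂ))

/-- The norm `‖w‖_{H^p} = (∫ (1 + ξ²)^p |ŵ(ξ)|² dξ)^{1/2}`, where `ŵ` is the unitary Fourier
transform with phase `e^{-iξt}`; it is written through Mathlib's Fourier transform, whose phase is
`e^{-2πiηt}`, by the substitution `ξ = 2πη`. -/
def hpNorm (p : ℝ) (w : L2line) : ℝ :=
  (eLpNorm (fun η : ℝ => (((1 + (2 * Real.pi * η) ^ 2) ^ (p / 2) : ℝ) : ℂ) * (𝓕 w : L2line) η)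
    2 volume).toReal

/-- `f_p(t) = (-ln t)^{-p}`; for `p > 0` its value at `0` is the limit `0`. -/
def logFun (p t : ℝ) : ℝ := (-Real.log t) ^ (-p)

/-- `Θ_p(t) = √t f_p(t)`. -/
def Theta (p t : ℝ) : ℝ := √t * logFun p t

/-- The inverse of the increasing bijection `Θ_p : (0,1) → (0,∞)`. -/
def ThetaInv (p : ℝ) : ℝ → ℝ := Function.invFunOn (Theta p) (Ioo 0 1)

/-- The a priori rule `β = (Θ_p^{-1}(δ/ρ))^{1/(2s)}`. -/
def betaRule (p s ρ δ : ℝ) : ℝ := ThetaInv p (δ / ρ) ^ (1 / (2 * s))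

/-- The normalized operator `L/√(πe)`. -/
def laplaceBar : L2pos →L[ℂ] L2pos :=
  ((1 / √(Real.pi * Real.exp 1) : ℝ) : ℂ) • laplaceOp

/-- The continuous functional calculus `F(A)` for a bounded selfadjoint operator `A` on a complex
Hilbert space and a real function `F` that is continuous on the spectrum of `A`. -/
def funCalc {H : Type*} [NormedAddCommGroup H] [InnerProductSpace ℂ H] [CompleteSpace H]
    (F : ℝ → ℝ) (A : H →L[ℂ] H) : H →L[ℂ] H :=
  cfc F A

/-- The operator `f_p(L̄* L̄)`, by the continuous functional calculus. -/
def logSourceOp (p : ℝ) : L2pos →L[ℂ] L2pos :=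
  funCalc (logFun p) (ContinuousLinearMap.adjoint laplaceBar ∘L laplaceBar)

end RealLaplace

end

/-! The unitary map `fourierV` (`V` followed by the Fourier transform) reduces all four claims to
estimates for scalar symbols. With `z = e^u`, `τ = e^v` the Laplace kernel depends only on `u + v`,
so `L` becomes a reflection followed by a convolution whose symbol is a Gamma function on the line
`Re = 1/2`. The reflection formula for Gamma turns `L* L` into multiplication by `m(η) = π /
cosh(2π²η)` (`adjoint_laplaceOp_comp`). After division by `πe` the symbol lies in `(0, e⁻¹]`, and
`f_p` of it is `σ(η) = (1 + ln cosh(2π²η))^{-p}` (`logSourceOp_eq`). Since `1 + ln cosh` grows like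
`|η|`, `σ` is comparable with the reciprocal of the `H^p` weight; this is the equivalence of norms.

`I - C_β` is multiplication by `b(η) = d(2πβη)`, where `d` is the defect `1 - √(2π) φ̂`. The normal
operator has symbol `N = m + b²`, which is bounded below because `m` is large at low and `b` at high
frequencies. It is therefore invertible and the minimizer is unique. The error is a bias with symbol
`b² σ / N`, applied to `w`, plus the propagated noise `N⁻¹ L*(Lf - g^δ)`
(`norm_sub_mollifiedSolution_le`).

Put `t = β^{2s}`. The noise is amplified by at most a constant times `1/√t` (`eventually_noise_le`),
and the bias factor is at most `2^p f_p(t)` (`eventually_bias_le`). The rule `Θ_p(t) = δ/ρ` says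
`δ/√t = ρ f_p(t)`, so both contributions have the same order. Finally `f_p(t)` is replaced by
`f_p(δ²/ρ²)` at the price of a factor `2^p` (`eventually_logFun_le`).

For the lower bound, a source concentrated at frequencies near `-ln(δ²/ρ²)/(2π²)` is damped by `L`
below the noise level, while the solution still has norm of order `ρ f_p(δ²/ρ²)`. This solution and
its negative are both compatible with the data `0`, and no reconstruction is close to both. -/

noncomputable section

namespace RealLaplace

open scoped BoundedContinuousFunction

/-! ### The Fourier transform on `L¹ ∩ L²` -/

/-- On `L¹ ∩ L²`, the Fourier transform of `L²` is given by the Fourier integral. -/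
theorem fourier_toLp_ae_eq {g : ℝ → ℂ} (h1 : Integrable g) (h2 : MemLp g 2 volume) :
    (𝓕 (h2.toLp g) : L2line) =ᵐ[volume] 𝓕 g := by
  have hc : Continuous (𝓕 g : ℝ → ℂ) := by
    have := (Real.Lp.fourierTransform (h1.toL1 g)).continuous
    rw [Real.Lp.coe_fourierTransform] at this
    have e : 𝓕 (h1.toL1 g : ℝ → ℂ) = 𝓕 g :=
      funext (Real.fourier_congr_ae h1.coeFn_toL1)
    rwa [e] at this
  refine ae_eq_of_integral_contDiff_smul_eq
    ((Lp.memLp (𝓕 (h2.toLp g) : L2line)).locallyIntegrable (by norm_num))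
    hc.locallyIntegrable fun u hu hus => ?_
  have hus' : HasCompactSupport (fun x => (u x : ℂ)) :=
    hus.comp_left (g := ((↑) : ℝ → ℂ)) Complex.ofReal_zero
  let v : 𝓢(ℝ, ℂ) := hus'.toSchwartzMap (Complex.ofRealCLM.contDiff.comp hu)
  have hv : ∀ x, v x = (u x : ℂ) := fun x => rfl
  have e := congrArg (fun T : 𝓢'(ℝ, ℂ) => T v)
    (Lp.fourier_toTemperedDistribution_eq (h2.toLp g))
  simp only [TemperedDistribution.fourier_apply, Lp.toTemperedDistribution_apply] at e
  calc ∫ x, u x • (𝓕 (h2.toLp g) : L2line) x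
      = ∫ x, v x • (𝓕 (h2.toLp g) : L2line) x := by
        refine integral_congr_ae (Eventually.of_forall fun x => ?_)
        simp [hv]
    _ = ∫ x, (𝓕 v) x • (h2.toLp g) x := e.symm
    _ = ∫ x, (𝓕 v) x • g x := by
        refine integral_congr_ae ?_
        filter_upwards [h2.coeFn_toLp] with x hx
        rw [hx]
    _ = ∫ x, v x • 𝓕 g x := by
        have := VectorFourier.integral_fourierIntegral_smul_eq_flip (L := innerₗ ℝ)
          Real.continuous_fourierChar continuous_inner (v.integrable (μ := volume)) h1
        rw [flip_innerₗ] at this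
        simp only [SchwartzMap.fourier_coe]
        exact this
    _ = ∫ x, u x • 𝓕 g x := by
        refine integral_congr_ae (Eventually.of_forall fun x => ?_)
        simp [hv]

/-! ### Multiplication operators on `L²(ℝ)` -/

theorem memLp_bcf_mul (a : ℝ →ᵇ ℂ) {w : ℝ → ℂ} (hw : MemLp w 2 volume) :
    MemLp (fun x => a x * w x) 2 volume :=
  hw.of_le_mul (c := ‖a‖) (a.continuous.aestronglyMeasurable.mul hw.1)
    (Eventually.of_forall fun x => by
      rw [norm_mul]
      gcongr
      exact a.norm_coe_le_norm x)

/-- The multiplication operator `w ↦ a w` on `L²(ℝ)`. -/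
def mulOp (a : ℝ →ᵇ ℂ) : L2line →L[ℂ] L2line :=
  LinearMap.mkContinuous
    { toFun := fun w => (memLp_bcf_mul a (Lp.memLp w)).toLp _
      map_add' := by
        intro f g
        rw [← MemLp.toLp_add, MemLp.toLp_eq_toLp_iff]
        filter_upwards [Lp.coeFn_add f g] with y hy
        simp only [Pi.add_apply, hy, mul_add]
      map_smul' := by
        intro c f
        rw [RingHom.id_apply, ← MemLp.toLp_const_smul, MemLp.toLp_eq_toLp_iff]
        filter_upwards [Lp.coeFn_smul c f] with y hy
        simp only [Pi.smul_apply, hy, smul_eq_mul]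
        ring } ‖a‖
    (by
      intro w
      refine Lp.norm_le_mul_norm_of_ae_le_mul ?_
      filter_upwards [(memLp_bcf_mul a (Lp.memLp w)).coeFn_toLp] with x hx
      simp only [LinearMap.coe_mk, AddHom.coe_mk, hx, norm_mul]
      gcongr
      exact a.norm_coe_le_norm x)

theorem mulOp_apply (a : ℝ →ᵇ ℂ) (w : L2line) :
    mulOp a w =ᵐ[volume] fun x => a x * w x :=
  (memLp_bcf_mul a (Lp.memLp w)).coeFn_toLp

/-- Multiplication operators form a representation of the bounded continuous functions. -/
def mulHom : (ℝ →ᵇ ℂ) →⋆ₐ[ℂ] (L2line →L[ℂ] L2line) where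
  toFun := mulOp
  map_one' := by
    ext1 w
    refine Lp.ext ?_
    filter_upwards [mulOp_apply 1 w] with x hx
    simp [hx]
  map_mul' a b := by
    ext1 w
    refine Lp.ext ?_
    filter_upwards [mulOp_apply (a * b) w, mulOp_apply a (mulOp b w), mulOp_apply b w]
      with x h1 h2 h3
    rw [mul_apply_eq_comp, h1, h2, h3, BoundedContinuousFunction.mul_apply, mul_assoc]
  map_zero' := by
    ext1 w
    refine Lp.ext ?_
    filter_upwards [mulOp_apply 0 w] with x hx
    simp [hx]
  map_add' a b := by
    ext1 w
    refine Lp.ext ?_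
    filter_upwards [mulOp_apply (a + b) w, mulOp_apply a w, mulOp_apply b w,
      Lp.coeFn_add (mulOp a w) (mulOp b w)] with x h1 h2 h3 h4
    rw [add_apply, h4, Pi.add_apply, h1, h2, h3,
      BoundedContinuousFunction.add_apply, add_mul]
  commutes' c := by
    ext1 w
    refine Lp.ext ?_
    filter_upwards [mulOp_apply (algebraMap ℂ _ c) w, Lp.coeFn_smul c w] with x h1 h2
    have h3 : (algebraMap ℂ (L2line →L[ℂ] L2line) c) w = c • w := by
      rw [Algebra.algebraMap_eq_smul_one]
      rfl
    rw [h1, h3, h2]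
    rfl
  map_star' a := by
    rw [ContinuousLinearMap.star_eq_adjoint, ContinuousLinearMap.eq_adjoint_iff]
    intro x y
    rw [L2.inner_def, L2.inner_def]
    refine integral_congr_ae ?_
    filter_upwards [mulOp_apply (star a) x, mulOp_apply a y] with t h1 h2
    rw [h1, h2]
    simp
    ring

theorem mulHom_apply (a : ℝ →ᵇ ℂ) (w : L2line) :
    mulHom a w =ᵐ[volume] fun x => a x * w x :=
  mulOp_apply a w

/-! ### Convolutions and reflections under the Fourier transform -/

/-- The Fourier transform of an integrable function, as a bounded continuous function. -/
def fourierBCF {ψ : ℝ → ℝ} (hψ : Integrable ψ) : ℝ →ᵇ ℂ :=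
  Real.Lp.fourierTransform (hψ.ofReal.toL1 (fun t => (ψ t : ℂ)))

theorem fourierBCF_apply {ψ : ℝ → ℝ} (hψ : Integrable ψ) (η : ℝ) :
    fourierBCF hψ η = 𝓕 (fun t => (ψ t : ℂ)) η := by
  rw [fourierBCF, Real.Lp.fourierTransform_apply]
  exact Real.fourier_congr_ae (Integrable.coeFn_toL1 _) η

theorem fourier_schwartz_toLp (w : 𝓢(ℝ, ℂ)) :
    (𝓕 (w.toLp 2 : L2line) : L2line) =ᵐ[volume] 𝓕 (w : ℝ → ℂ) := by
  rw [SchwartzMap.toLp_fourier_eq]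
  filter_upwards [(𝓕 w).coeFn_toLp 2 volume] with x hx
  rw [hx, SchwartzMap.fourier_coe]

/-- Density of Schwartz functions: operator identities need checking only where the Fourier
transform is a genuine integral. -/
theorem ext_schwartz {A B : L2line →L[ℂ] L2line}
    (h : ∀ w : 𝓢(ℝ, ℂ), A (w.toLp 2) = B (w.toLp 2)) (w : L2line) : A w = B w := by
  refine DenseRange.induction_on (p := fun w => A w = B w)
    (SchwartzMap.denseRange_toLpCLM (E := ℝ) (F := ℂ) (μ := volume) (p := 2)
      ENNReal.ofNat_ne_top) w ?_ ?_
  · exact isClosed_eq A.continuous B.continuous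
  · intro w
    exact h w

/-- The convolution theorem for an `L¹` kernel and an `L²` function. -/
theorem fourier_kernelOp {ψ : ℝ → ℝ} (hψ : Integrable ψ) (w : L2line) :
    (𝓕 (kernelOp (convolution_boundedKernel hψ) w) : L2line) =
      mulHom (fourierBCF hψ) (𝓕 w) := by
  refine ext_schwartz
    (A := (Lp.fourierTransformₗᵢ ℝ ℂ).toContinuousLinearEquiv.toContinuousLinearMap ∘L
      kernelOp (convolution_boundedKernel hψ))
    (B := mulHom (fourierBCF hψ) ∘L
      (Lp.fourierTransformₗᵢ ℝ ℂ).toContinuousLinearEquiv.toContinuousLinearMap) ?_ w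
  intro w
  change (𝓕 (kernelOp (convolution_boundedKernel hψ) (w.toLp 2)) : L2line) =
      mulHom (fourierBCF hψ) (𝓕 (w.toLp 2 : L2line) : L2line)
  set g : ℝ → ℂ := MeasureTheory.convolution (fun t => (ψ t : ℂ)) w
    (ContinuousLinearMap.mul ℂ ℂ) volume with hg
  have hψc : Integrable fun t => (ψ t : ℂ) := hψ.ofReal
  have hg1 : Integrable g := hψc.integrable_convolution _ w.integrable
  have hgK : kernelOp (convolution_boundedKernel hψ) (w.toLp 2) =ᵐ[volume] g := by
    filter_upwards [kernelOp_apply (convolution_boundedKernel hψ) (w.toLp 2)] with x hx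
    rw [hx, hg, convolution_eq_swap]
    refine integral_congr_ae ?_
    filter_upwards [w.coeFn_toLp 2 volume] with y hy
    rw [hy]
    rfl
  -- Square integrability of the convolution is inherited from the bounded operator with which it
  -- agrees almost everywhere.
  have hg2 : MemLp g 2 volume := (memLp_congr_ae hgK).1 (Lp.memLp _)
  have hgL : kernelOp (convolution_boundedKernel hψ) (w.toLp 2) = hg2.toLp g :=
    Lp.ext (hgK.trans hg2.coeFn_toLp.symm)
  rw [hgL]
  refine Lp.ext ?_
  filter_upwards [fourier_toLp_ae_eq hg1 hg2, mulHom_apply (fourierBCF hψ) (𝓕 (w.toLp 2 : L2line)),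
    fourier_schwartz_toLp w] with x h1 h2 h3
  rw [h1, h2, h3, fourierBCF_apply, hg,
    Real.fourier_mul_convolution_eq hψc w.integrable]

/-- The reflection `w ↦ w(-·)` on `L²(ℝ)`. -/
def reflect : L2line →ₗᵢ[ℂ] L2line :=
  Lp.compMeasurePreservingₗᵢ ℂ (fun x : ℝ => -x) (Measure.measurePreserving_neg volume)

theorem reflect_apply (w : L2line) : reflect w =ᵐ[volume] fun x => w (-x) :=
  Lp.coeFn_compMeasurePreserving w (Measure.measurePreserving_neg volume)

theorem fourier_reflect (w : L2line) :
    (𝓕 (reflect w) : L2line) = reflect (𝓕 w) := by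
  refine ext_schwartz
    (A := (Lp.fourierTransformₗᵢ ℝ ℂ).toContinuousLinearEquiv.toContinuousLinearMap ∘L
      reflect.toContinuousLinearMap)
    (B := reflect.toContinuousLinearMap ∘L
      (Lp.fourierTransformₗᵢ ℝ ℂ).toContinuousLinearEquiv.toContinuousLinearMap) ?_ w
  intro w
  change (𝓕 (reflect (w.toLp 2)) : L2line) = reflect (𝓕 (w.toLp 2 : L2line) : L2line)
  have hneg := (Measure.measurePreserving_neg (volume : Measure ℝ)).quasiMeasurePreserving
  have hg1 : Integrable fun x : ℝ => w (-x) := w.integrable.comp_neg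
  have hgK : reflect (w.toLp 2) =ᵐ[volume] fun x => w (-x) := by
    filter_upwards [reflect_apply (w.toLp 2), hneg.ae (w.coeFn_toLp 2 volume)] with x h1 h2
    rw [h1, h2]
  have hg2 : MemLp (fun x : ℝ => w (-x)) 2 volume := (memLp_congr_ae hgK).1 (Lp.memLp _)
  have hgL : reflect (w.toLp 2) = hg2.toLp _ :=
    Lp.ext (hgK.trans hg2.coeFn_toLp.symm)
  rw [hgL]
  refine Lp.ext ?_
  filter_upwards [fourier_toLp_ae_eq hg1 hg2, reflect_apply (𝓕 (w.toLp 2 : L2line)),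
    hneg.ae (fourier_schwartz_toLp w)] with x h1 h2 h3
  rw [h1, h2, h3, ← Real.fourierInv_eq_fourier_neg, Real.fourierInv_eq_fourier_comp_neg]

/-! ### The unitary map `f ↦ 𝓕 (V f)` -/

theorem vTransform_surjective : Function.Surjective vTransform := by
  intro w
  -- The preimage is `x^{-1/2} w(ln x)`.
  let g : ℝ → ℂ := fun x => (Real.exp (-(Real.log x / 2)) : ℂ) * w (Real.log x)
  have hg : ∀ u : ℝ, (Real.exp (u / 2) : ℂ) * g (Real.exp u) = w u := by
    intro u
    simp only [g, Real.log_exp]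
    rw [← mul_assoc, ← Complex.ofReal_mul, ← Real.exp_add]
    simp
  have hm : StronglyMeasurable g := by
    refine StronglyMeasurable.mul ?_
      ((Lp.stronglyMeasurable w).comp_measurable Real.measurable_log)
    exact (Complex.measurable_ofReal.comp
      (Real.measurable_exp.comp (Real.measurable_log.div_const 2).neg)).stronglyMeasurable
  have hL : MemLp g 2 ((volume : Measure ℝ).restrict (Ioi 0)) := by
    refine ⟨hm.aestronglyMeasurable, ?_⟩
    have : eLpNorm g 2 ((volume : Measure ℝ).restrict (Ioi 0)) ^ 2 < ∞ := by
      rw [eLpNorm_two_sq, ← vTransform_lintegral]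
      simp only [hg]
      rw [← eLpNorm_two_sq]
      exact ENNReal.pow_lt_top (Lp.memLp w).2
    simpa using this
  refine ⟨hL.toLp g, Lp.ext ?_⟩
  filter_upwards [vTransform_apply (hL.toLp g), quasiMeasurePreserving_exp.ae hL.coeFn_toLp]
    with u h1 h2
  rw [h1, h2, hg]

/-- The unitary map `f ↦ 𝓕 (V f)` from `L²(0,∞)` to `L²(ℝ)`. -/
def fourierV : L2pos ≃ₗᵢ[ℂ] L2line :=
  (LinearIsometryEquiv.ofSurjective vTransform vTransform_surjective).trans
    (Lp.fourierTransformₗᵢ ℝ ℂ)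

theorem fourierV_apply (f : L2pos) : fourierV f = (𝓕 (vTransform f) : L2line) := rfl

/-- The operator on `L²(0,∞)` that becomes multiplication by `a` under `fourierV`. -/
def multHom : (ℝ →ᵇ ℂ) →⋆ₐ[ℂ] (L2pos →L[ℂ] L2pos) :=
  (fourierV.symm.conjStarAlgEquiv : (L2line →L[ℂ] L2line) →⋆ₐ[ℂ] (L2pos →L[ℂ] L2pos)).comp mulHom

theorem fourierV_multHom (a : ℝ →ᵇ ℂ) (f : L2pos) :
    fourierV (multHom a f) = mulHom a (fourierV f) :=
  fourierV.apply_symm_apply _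

theorem fourierV_multHom_ae (a : ℝ →ᵇ ℂ) (f : L2pos) :
    fourierV (multHom a f) =ᵐ[volume] fun η => a η * fourierV f η := by
  rw [fourierV_multHom]
  exact mulHom_apply a _

theorem norm_multHom_le (a : ℝ →ᵇ ℂ) (f : L2pos) {C : ℝ} (hC : ∀ η, ‖a η‖ ≤ C) :
    ‖multHom a f‖ ≤ C * ‖f‖ := by
  rw [← fourierV.norm_map, ← fourierV.norm_map f]
  refine Lp.norm_le_mul_norm_of_ae_le_mul ?_
  filter_upwards [fourierV_multHom_ae a f] with η h
  rw [h, norm_mul]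
  gcongr
  exact hC η

/-! ### The continuous functional calculus of a multiplication operator -/

/-- A bounded continuous real function, as an element of `ℝ →ᵇ ℂ`. -/
def realSymbol (r : ℝ → ℝ) (hr : Continuous r) (C : ℝ) (hC : ∀ η, |r η| ≤ C) : ℝ →ᵇ ℂ :=
  BoundedContinuousFunction.ofNormedAddCommGroup (fun η => (r η : ℂ)) (by fun_prop) C
    (fun η => by rw [Complex.norm_real]; exact hC η)

@[simp]
theorem realSymbol_apply (r : ℝ → ℝ) (hr : Continuous r) (C : ℝ) (hC : ∀ η, |r η| ≤ C) (η : ℝ) :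
    realSymbol r hr C hC η = (r η : ℂ) := rfl

/-- Evaluation at a point, as a star algebra homomorphism. -/
def bcfEval (η : ℝ) : (ℝ →ᵇ ℂ) →⋆ₐ[ℂ] ℂ where
  toFun a := a η
  map_one' := rfl
  map_mul' _ _ := rfl
  map_zero' := rfl
  map_add' _ _ := rfl
  commutes' _ := rfl
  map_star' _ := rfl

/-- A point outside the interval has positive distance to the range of the symbol, so the pointwise
reciprocal is bounded and continuous and serves as an inverse. -/
theorem spectrum_subset_Icc {a : ℝ →ᵇ ℂ} {r : ℝ → ℝ} (ha : ∀ η, a η = r η) {lo hi : ℝ}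
    (hr : ∀ η, r η ∈ Icc lo hi) : spectrum ℝ a ⊆ Icc lo hi := by
  intro x hx
  by_contra hxn
  obtain ⟨d, hd, hdx⟩ : ∃ d > 0, ∀ η, d ≤ |x - r η| := by
    rw [mem_Icc, not_and_or, not_le, not_le] at hxn
    rcases hxn with h | h
    · refine ⟨lo - x, by linarith, fun η => ?_⟩
      rw [abs_sub_comm]
      exact le_trans (by linarith [(hr η).1]) (le_abs_self _)
    · refine ⟨x - hi, by linarith, fun η => ?_⟩
      exact le_trans (by linarith [(hr η).2]) (le_abs_self _)
  have hne : ∀ η, (x : ℂ) - a η ≠ 0 := fun η h => by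
    rw [ha, ← Complex.ofReal_sub, Complex.ofReal_eq_zero] at h
    have := hdx η
    rw [h, abs_zero] at this
    linarith
  let b : ℝ →ᵇ ℂ := BoundedContinuousFunction.ofNormedAddCommGroup (fun η => ((x : ℂ) - a η)⁻¹)
    ((continuous_const.sub a.continuous).inv₀ hne) d⁻¹ (fun η => by
      rw [norm_inv, ha, ← Complex.ofReal_sub, Complex.norm_real]
      exact inv_anti₀ hd (hdx η))
  have e : ∀ η, (algebraMap ℝ (ℝ →ᵇ ℂ) x - a) η = (x : ℂ) - a η := fun η => by
    rw [BoundedContinuousFunction.sub_apply]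
    congr 1
  refine hx ?_
  refine IsUnit.of_mul_eq_one b ?_
  ext η
  rw [BoundedContinuousFunction.mul_apply, e]
  exact mul_inv_cancel₀ (hne η)

theorem isSelfAdjoint_of_real {a : ℝ →ᵇ ℂ} {r : ℝ → ℝ} (ha : ∀ η, a η = r η) :
    IsSelfAdjoint a := by
  ext η
  rw [BoundedContinuousFunction.star_apply, ha]
  simp

/-- Star homomorphisms into bounded operators transport the continuous functional calculus; the
transported element is determined through the characters. -/
theorem exists_map_funCalc {A H : Type*} [CStarAlgebra A] [NormedAddCommGroup H]
    [InnerProductSpace ℂ H] [CompleteSpace H] (Φ : A →⋆ₐ[ℂ] (H →L[ℂ] H)) {F : ℝ → ℝ} {a : A}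
    (ha : IsSelfAdjoint a) (hF : ContinuousOn F (spectrum ℝ a)) (hΦ : Continuous Φ) :
    ∃ b : A, (∀ χ : A →⋆ₐ[ℂ] ℂ, Continuous χ → χ b = cfc F (χ a)) ∧ Φ b = funCalc F (Φ a) :=
  ⟨cfc F a, fun χ hχ => StarAlgHom.map_cfc χ F a hF hχ ha (ha.map χ),
    StarAlgHom.map_cfc Φ F a hF hΦ ha (ha.map Φ)⟩

theorem continuous_multHom : Continuous multHom := by
  refine AddMonoidHomClass.continuous_of_bound multHom 1 fun a => ?_
  refine ContinuousLinearMap.opNorm_le_bound _ (by positivity) fun f => ?_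
  rw [one_mul]
  exact norm_multHom_le a f a.norm_coe_le_norm

/-- Point evaluations are continuous characters that separate bounded continuous functions. They
commute with the functional calculus, hence the symbol is determined pointwise. -/
theorem funCalc_multHom {a b : ℝ →ᵇ ℂ} {r : ℝ → ℝ} (ha : ∀ η, a η = r η) {lo hi : ℝ}
    (hr : ∀ η, r η ∈ Icc lo hi) {F : ℝ → ℝ} (hF : ContinuousOn F (Icc lo hi))
    (hb : ∀ η, b η = F (r η)) : funCalc F (multHom a) = multHom b := by
  obtain ⟨b', h1, h2⟩ := exists_map_funCalc multHom (isSelfAdjoint_of_real ha)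
    (hF.mono (spectrum_subset_Icc ha hr)) continuous_multHom
  rw [← h2]
  congr 1
  ext η
  have h3 := h1 (bcfEval η)
    ((continuous_apply η).comp BoundedContinuousFunction.continuous_coe)
  change b' η = cfc F (a η) at h3
  rw [h3, hb, ha]
  exact cfc_algebraMap (A := ℂ) (r η) F

/-! ### The Laplace transform as a multiplier -/

/-- The kernel of `V L V⁻¹` in the variable `u + v`. -/
def laplaceKernel (x : ℝ) : ℝ := Real.exp (x / 2) * Real.exp (-Real.exp x)

theorem integral_comp_exp (G : ℝ → ℂ) :
    ∫ u : ℝ, (Real.exp u : ℂ) * G (Real.exp u) = ∫ x in Ioi (0 : ℝ), G x := by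
  have h := integral_image_eq_integral_abs_deriv_smul (s := univ) (f := Real.exp)
    (f' := Real.exp) MeasurableSet.univ (fun x _ => (Real.hasDerivAt_exp x).hasDerivWithinAt)
    Real.exp_injective.injOn G
  rw [image_univ, Real.range_exp, Measure.restrict_univ] at h
  rw [h]
  simp [abs_of_pos (Real.exp_pos _)]

theorem integrable_laplaceKernel : Integrable laplaceKernel := by
  have h := integrableOn_image_iff_integrableOn_abs_deriv_smul (s := univ) (f := Real.exp)
    (f' := Real.exp) MeasurableSet.univ (fun x _ => (Real.hasDerivAt_exp x).hasDerivWithinAt)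
    Real.exp_injective.injOn (fun x => Real.exp (-x) * x ^ ((1 / 2 : ℝ) - 1))
  rw [image_univ, Real.range_exp, integrableOn_univ] at h
  refine (h.1 (Real.GammaIntegral_convergent (by norm_num))).congr
    (Eventually.of_forall fun x => ?_)
  simp only [abs_of_pos (Real.exp_pos _), laplaceKernel, smul_eq_mul]
  rw [← Real.exp_mul, ← Real.exp_add, ← Real.exp_add, ← Real.exp_add]
  congr 1
  ring

/-- Euler's integral for Gamma under the substitution `τ = e^x`. -/
theorem fourier_laplaceKernel (η : ℝ) :
    𝓕 (fun x => (laplaceKernel x : ℂ)) η =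
      Complex.Gamma (1 / 2 - 2 * Real.pi * η * Complex.I) := by
  rw [Complex.Gamma_eq_integral (by simp), Complex.GammaIntegral, ← integral_comp_exp,
    Real.fourier_real_eq_integral_exp_smul]
  refine integral_congr_ae (Eventually.of_forall fun x => ?_)
  simp only [laplaceKernel, smul_eq_mul]
  rw [Complex.cpow_def_of_ne_zero (by simp), ← Complex.ofReal_log (Real.exp_pos x).le,
    Real.log_exp]
  push_cast
  rw [← Complex.exp_add, ← Complex.exp_add, ← Complex.exp_add, ← Complex.exp_add]
  congr 1
  ring

/-- In logarithmic variables `e^{-zτ}` is a function of `u + v`; reflecting the argument turns the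
sum into the difference of a convolution. -/
theorem vTransform_laplaceOp (f : L2pos) :
    vTransform (laplaceOp f) =
      kernelOp (convolution_boundedKernel integrable_laplaceKernel) (reflect (vTransform f)) := by
  refine Lp.ext ?_
  filter_upwards [vTransform_apply (laplaceOp f),
    quasiMeasurePreserving_exp.ae (kernelOp_apply laplace_boundedKernel f),
    kernelOp_apply (convolution_boundedKernel integrable_laplaceKernel) (reflect (vTransform f))]
    with u h1 h2 h3
  rw [h1, h3, laplaceOp, h2]
  have e1 : ∫ y, (laplaceKernel (u - y) : ℂ) * reflect (vTransform f) y =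
      ∫ y, (laplaceKernel (u - y) : ℂ) * vTransform f (-y) := by
    refine integral_congr_ae ?_
    filter_upwards [reflect_apply (vTransform f)] with y hy
    rw [hy]
  have e2 : ∫ y, (laplaceKernel (u - y) : ℂ) * vTransform f (-y) =
      ∫ y, (laplaceKernel (u + y) : ℂ) * vTransform f y := by
    rw [← integral_neg_eq_self]
    simp
  rw [e1, e2, ← integral_comp_exp, ← integral_const_mul]
  refine integral_congr_ae ?_
  filter_upwards [vTransform_apply f] with y hy
  rw [hy, laplaceKernel]
  simp only [← mul_assoc]
  congr 1
  push_cast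
  simp only [← Complex.exp_add]
  congr 1
  ring

theorem fourierV_laplaceOp (f : L2pos) :
    fourierV (laplaceOp f) =
      mulHom (fourierBCF integrable_laplaceKernel) (reflect (fourierV f)) := by
  rw [fourierV_apply, vTransform_laplaceOp, fourier_kernelOp, fourier_reflect, fourierV_apply]

/-- The symbol `π / cosh (2π²η)` of `L* L`. -/
def lapSymbol (η : ℝ) : ℝ := Real.pi / Real.cosh (2 * Real.pi ^ 2 * η)

theorem continuous_lapSymbol : Continuous lapSymbol :=
  continuous_const.div (by fun_prop) fun η => (Real.cosh_pos _).ne'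

theorem lapSymbol_pos (η : ℝ) : 0 < lapSymbol η := div_pos Real.pi_pos (Real.cosh_pos _)

theorem lapSymbol_le (η : ℝ) : lapSymbol η ≤ Real.pi :=
  div_le_self Real.pi_pos.le (Real.one_le_cosh _)

theorem abs_lapSymbol_le (η : ℝ) : |lapSymbol η| ≤ Real.pi := by
  rw [abs_of_pos (lapSymbol_pos η)]
  exact lapSymbol_le η

theorem lapSymbol_neg (η : ℝ) : lapSymbol (-η) = lapSymbol η := by
  simp [lapSymbol]

/-- `π / cosh (2π²η)` as a bounded continuous function. -/
def lapBCF : ℝ →ᵇ ℂ := realSymbol lapSymbol continuous_lapSymbol Real.pi abs_lapSymbol_le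

/-- Conjugation maps `1/2 - ix` to `1/2 + ix`, so the product is `Γ(z) Γ(1 - z) = π / sin(πz)` on
the line `Re z = 1/2`, where the sine becomes a hyperbolic cosine. -/
theorem conj_mul_fourierBCF_laplaceKernel (η : ℝ) :
    (starRingEnd ℂ) (fourierBCF integrable_laplaceKernel η) *
      fourierBCF integrable_laplaceKernel η = lapSymbol η := by
  rw [fourierBCF_apply, fourier_laplaceKernel, ← Complex.Gamma_conj]
  have h := Complex.Gamma_mul_Gamma_one_sub (1 / 2 + 2 * Real.pi * η * Complex.I)
  have e1 : (1 : ℂ) - (1 / 2 + 2 * Real.pi * η * Complex.I) =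
      1 / 2 - 2 * Real.pi * η * Complex.I := by ring
  have e2 : (starRingEnd ℂ) (1 / 2 - 2 * Real.pi * η * Complex.I) =
      1 / 2 + 2 * Real.pi * η * Complex.I := by
    simp only [map_sub, map_mul, map_div₀, map_one, Complex.conj_ofReal, Complex.conj_I, map_ofNat]
    ring
  rw [e1] at h
  rw [e2, h, lapSymbol]
  have e3 : (Real.pi : ℂ) * (1 / 2 + 2 * Real.pi * η * Complex.I) =
      (2 * Real.pi ^ 2 * η : ℝ) * Complex.I + Real.pi / 2 := by
    push_cast; ring
  rw [e3, Complex.sin_add_pi_div_two, Complex.cos_mul_I]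
  push_cast
  rfl

/-- `L` itself is not a multiplier because of the reflection. In `L* L` the reflection occurs twice
and cancels, the symbol being even. -/
theorem inner_laplaceOp (x y : L2pos) :
    inner ℂ (laplaceOp x) (laplaceOp y) = inner ℂ x (multHom lapBCF y) := by
  rw [← fourierV.inner_map_map, ← fourierV.inner_map_map x, fourierV_laplaceOp,
    fourierV_laplaceOp, ← reflect.inner_map_map (fourierV x), L2.inner_def, L2.inner_def]
  refine integral_congr_ae ?_
  have hneg := (Measure.measurePreserving_neg (volume : Measure ℝ)).quasiMeasurePreserving
  filter_upwards [mulHom_apply (fourierBCF integrable_laplaceKernel) (reflect (fourierV x)),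
    mulHom_apply (fourierBCF integrable_laplaceKernel) (reflect (fourierV y)),
    reflect_apply (fourierV (multHom lapBCF y)), reflect_apply (fourierV y),
    hneg.ae (fourierV_multHom_ae lapBCF y)] with η h1 h2 h3 h4 h5
  have h6 := conj_mul_fourierBCF_laplaceKernel η
  have h7 : lapBCF (-η) = lapSymbol η := by
    rw [lapBCF, realSymbol_apply, lapSymbol_neg]
  rw [h1, h2, h3, h5, h7, ← h6, h4]
  simp only [RCLike.inner_apply, map_mul]
  ring

theorem adjoint_laplaceOp_comp : ContinuousLinearMap.adjoint laplaceOp ∘L laplaceOp =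
    multHom lapBCF := by
  ext1 y
  refine ext_inner_left ℂ fun x => ?_
  rw [ContinuousLinearMap.comp_apply, ContinuousLinearMap.adjoint_inner_right, inner_laplaceOp]

/-! ### The logarithmic weight -/

/-- The weight `1 + ln cosh (2π²η)`. -/
def logWeight (η : ℝ) : ℝ := 1 + Real.log (Real.cosh (2 * Real.pi ^ 2 * η))

theorem continuous_logWeight : Continuous logWeight :=
  continuous_const.add
    (Continuous.log (by fun_prop) fun _ => (Real.cosh_pos _).ne')

theorem one_le_logWeight (η : ℝ) : 1 ≤ logWeight η :=
  le_add_of_nonneg_right (Real.log_nonneg (Real.one_le_cosh _))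

theorem logWeight_pos (η : ℝ) : 0 < logWeight η := zero_lt_one.trans_le (one_le_logWeight η)

theorem log_cosh_le (x : ℝ) : Real.log (Real.cosh x) ≤ |x| := by
  rw [Real.log_le_iff_le_exp (Real.cosh_pos x), ← Real.cosh_abs, Real.cosh_eq]
  have : Real.exp (-|x|) ≤ Real.exp |x| := Real.exp_le_exp.2 (by linarith [abs_nonneg x])
  linarith

theorem abs_sub_log_two_le (x : ℝ) : |x| - Real.log 2 ≤ Real.log (Real.cosh x) := by
  rw [Real.le_log_iff_exp_le (Real.cosh_pos x), Real.exp_sub, Real.exp_log (by norm_num),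
    ← Real.cosh_abs, Real.cosh_eq]
  have := Real.exp_pos (-|x|)
  linarith

/-- The summand `1` in the weight absorbs the loss `ln 2 < 1`. -/
theorem abs_le_logWeight (η : ℝ) : 2 * Real.pi ^ 2 * |η| ≤ logWeight η := by
  have h := abs_sub_log_two_le (2 * Real.pi ^ 2 * η)
  rw [abs_mul, abs_of_pos (by positivity : (0 : ℝ) < 2 * Real.pi ^ 2)] at h
  have := Real.log_two_lt_d9
  rw [logWeight]
  linarith

theorem logWeight_le (η : ℝ) : logWeight η ≤ 1 + 2 * Real.pi ^ 2 * |η| := by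
  have h := log_cosh_le (2 * Real.pi ^ 2 * η)
  rw [abs_mul, abs_of_pos (by positivity : (0 : ℝ) < 2 * Real.pi ^ 2)] at h
  rw [logWeight]
  linarith

theorem sqrt_weight_le (η : ℝ) : √(1 + (2 * Real.pi * η) ^ 2) ≤ 2 * logWeight η := by
  have h1 := one_le_logWeight η
  have h2 := abs_le_logWeight η
  have hpi := Real.pi_gt_three
  rw [Real.sqrt_le_left (by linarith), ← sq_abs (2 * Real.pi * η), abs_mul,
    abs_of_pos (by positivity : (0 : ℝ) < 2 * Real.pi)]
  have h3 : 2 * Real.pi * |η| ≤ logWeight η := by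
    refine le_trans ?_ h2
    have := abs_nonneg η
    gcongr
    nlinarith
  have h4 : 0 ≤ 2 * Real.pi * |η| := by positivity
  nlinarith

theorem logWeight_le_sqrt_weight (η : ℝ) : logWeight η ≤ 5 * √(1 + (2 * Real.pi * η) ^ 2) := by
  refine (logWeight_le η).trans ?_
  have h1 : 1 ≤ √(1 + (2 * Real.pi * η) ^ 2) := by
    rw [Real.one_le_sqrt]
    nlinarith [sq_nonneg (2 * Real.pi * η)]
  have h2 : 2 * Real.pi * |η| ≤ √(1 + (2 * Real.pi * η) ^ 2) := by
    apply Real.le_sqrt_of_sq_le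
    rw [mul_pow, sq_abs, ← mul_pow]
    linarith
  -- `2π²|η| = π · 2π|η|` is at most `4` times the root, and the summand `1` brings the constant to
  -- `5`.
  have hpi := Real.pi_le_four
  have h3 : 0 ≤ 2 * Real.pi * |η| := by positivity
  nlinarith

theorem rpow_half_eq (p x : ℝ) (hx : 0 ≤ x) : x ^ (p / 2) = √x ^ p := by
  rw [Real.sqrt_eq_rpow, ← Real.rpow_mul hx]
  congr 1
  ring

theorem hpWeight_le {p : ℝ} (hp : 0 < p) (η : ℝ) :
    (1 + (2 * Real.pi * η) ^ 2) ^ (p / 2) ≤ 2 ^ p * logWeight η ^ p := by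
  rw [rpow_half_eq _ _ (by positivity), ← Real.mul_rpow (by norm_num) (logWeight_pos η).le]
  exact Real.rpow_le_rpow (Real.sqrt_nonneg _) (sqrt_weight_le η) hp.le

theorem logWeight_rpow_le {p : ℝ} (hp : 0 < p) (η : ℝ) :
    logWeight η ^ p ≤ 5 ^ p * (1 + (2 * Real.pi * η) ^ 2) ^ (p / 2) := by
  rw [rpow_half_eq _ _ (by positivity), ← Real.mul_rpow (by norm_num) (Real.sqrt_nonneg _)]
  exact Real.rpow_le_rpow (logWeight_pos η).le (logWeight_le_sqrt_weight η) hp.le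

/-- The symbol `(1 + ln cosh (2π²η))^{-p}` of `f_p(L̄* L̄)`. -/
def sourceSymbol (p η : ℝ) : ℝ := logWeight η ^ (-p)

theorem continuous_sourceSymbol (p : ℝ) : Continuous (sourceSymbol p) :=
  continuous_logWeight.rpow_const fun η => Or.inl (logWeight_pos η).ne'

theorem sourceSymbol_pos (p η : ℝ) : 0 < sourceSymbol p η := Real.rpow_pos_of_pos (logWeight_pos η) _

theorem sourceSymbol_le_one {p : ℝ} (hp : 0 < p) (η : ℝ) : sourceSymbol p η ≤ 1 :=
  Real.rpow_le_one_of_one_le_of_nonpos (one_le_logWeight η) (by linarith)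

theorem abs_sourceSymbol_le {p : ℝ} (hp : 0 < p) (η : ℝ) : |sourceSymbol p η| ≤ 1 := by
  rw [abs_of_pos (sourceSymbol_pos p η)]
  exact sourceSymbol_le_one hp η

theorem sourceSymbol_mul_rpow (p η : ℝ) : sourceSymbol p η * logWeight η ^ p = 1 := by
  rw [sourceSymbol, ← Real.rpow_add (logWeight_pos η), neg_add_cancel, Real.rpow_zero]

/-- `(1 + ln cosh (2π²η))^{-p}` as a bounded continuous function. -/
def sourceBCF {p : ℝ} (hp : 0 < p) : ℝ →ᵇ ℂ :=
  realSymbol (sourceSymbol p) (continuous_sourceSymbol p) 1 (abs_sourceSymbol_le hp)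

theorem sourceBCF_apply {p : ℝ} (hp : 0 < p) (η : ℝ) : sourceBCF hp η = (sourceSymbol p η : ℂ) :=
  rfl

/-- Stopping at `e⁻¹` keeps clear of the singularity at `t = 1`; this is what the normalization by
`πe` is for. -/
theorem continuousOn_logFun {p : ℝ} (hp : 0 < p) :
    ContinuousOn (logFun p) (Icc 0 (Real.exp (-1))) := by
  intro t ht
  refine ContinuousAt.continuousWithinAt ?_
  rcases eq_or_lt_of_le ht.1 with rfl | h0
  -- The convention `Real.log 0 = 0` makes the value at `0` equal to `0^{-p} = 0`, which is also the
  -- two-sided limit.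
  · rw [← continuousWithinAt_compl_self, ContinuousWithinAt]
    have e : logFun p 0 = 0 := by
      rw [logFun, Real.log_zero, neg_zero, Real.zero_rpow (by linarith)]
    rw [e]
    exact (tendsto_rpow_neg_atTop hp).comp
      (tendsto_neg_atBot_atTop.comp Real.tendsto_log_nhdsNE_zero)
  · refine ContinuousAt.rpow_const ((Real.continuousAt_log h0.ne').neg) (Or.inl ?_)
    have : Real.log t ≤ -1 := by
      rw [Real.log_le_iff_le_exp h0]
      exact ht.2
    linarith

theorem logSourceOp_eq {p : ℝ} (hp : 0 < p) : logSourceOp p = multHom (sourceBCF hp) := by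
  have hpe : 0 < Real.pi * Real.exp 1 := by positivity
  have e : ContinuousLinearMap.adjoint laplaceBar ∘L laplaceBar =
      multHom ((((1 / (Real.pi * Real.exp 1)) : ℝ) : ℂ) • lapBCF) := by
    rw [map_smul, ← adjoint_laplaceOp_comp, laplaceBar, map_smulₛₗ,
      ContinuousLinearMap.smul_comp, ContinuousLinearMap.comp_smul, smul_smul,
      Complex.conj_ofReal, ← Complex.ofReal_mul]
    have e2 : 1 / √(Real.pi * Real.exp 1) * (1 / √(Real.pi * Real.exp 1)) =
        1 / (Real.pi * Real.exp 1) := by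
      rw [div_mul_div_comm, Real.mul_self_sqrt hpe.le, one_mul]
    rw [e2]
  have hval : ∀ η, 1 / (Real.pi * Real.exp 1) * lapSymbol η =
      Real.exp (-1) / Real.cosh (2 * Real.pi ^ 2 * η) := fun η => by
    have := Real.cosh_pos (2 * Real.pi ^ 2 * η)
    rw [lapSymbol, Real.exp_neg]
    field_simp
  rw [logSourceOp, e]
  refine funCalc_multHom (r := fun η => Real.exp (-1) / Real.cosh (2 * Real.pi ^ 2 * η))
    (lo := 0) (hi := Real.exp (-1)) (fun η => ?_) (fun η => ⟨?_, ?_⟩) (continuousOn_logFun hp)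
    fun η => ?_
  · rw [← hval, BoundedContinuousFunction.smul_apply, lapBCF, realSymbol_apply, smul_eq_mul]
    push_cast
    rfl
  · exact div_nonneg (Real.exp_pos _).le (Real.cosh_pos _).le
  · exact div_le_self (Real.exp_pos _).le (Real.one_le_cosh _)
  · rw [sourceBCF_apply, sourceSymbol, logFun, Real.log_div (Real.exp_pos _).ne'
      (Real.cosh_pos _).ne', Real.log_exp, logWeight]
    congr 3
    ring

/-! ### The Sobolev space -/

/-- Testing with compactly supported smooth functions identifies the distributional product with a
function. The weight here lacks the factor `2π` present in `hpNorm`; `one_add_sq_le` and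
`le_one_add_sq` compare the two through `1 ≤ 2π ≤ 7`. -/
theorem memHp_iff (p : ℝ) (w : L2line) :
    MemHp p w ↔ MemLp (fun η : ℝ => (((1 + ‖η‖ ^ 2) ^ (p / 2) : ℝ) : ℂ) * (𝓕 w : L2line) η)
      2 volume := by
  have htg : Function.HasTemperateGrowth (fun x : ℝ => (((1 + ‖x‖ ^ 2) ^ (p / 2) : ℝ) : ℂ)) := by
    fun_prop
  have key : ∀ u : 𝓢(ℝ, ℂ), TemperedDistribution.smulLeftCLM ℂ
      (fun x : ℝ => (((1 + ‖x‖ ^ 2) ^ (p / 2) : ℝ) : ℂ)) (𝓕 (w : 𝓢'(ℝ, ℂ))) u =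
      ∫ x, u x • ((((1 + ‖x‖ ^ 2) ^ (p / 2) : ℝ) : ℂ) * (𝓕 w : L2line) x) := by
    intro u
    rw [Lp.fourier_toTemperedDistribution_eq, TemperedDistribution.smulLeftCLM_apply_apply,
      Lp.toTemperedDistribution_apply]
    refine integral_congr_ae (Eventually.of_forall fun x => ?_)
    simp only [SchwartzMap.smulLeftCLM_apply_apply htg, smul_eq_mul]
    ring
  rw [MemHp, TemperedDistribution.memSobolev_iff_exists_smulLeftCLM_fourier]
  constructor
  · rintro ⟨f', hf'⟩
    refine (memLp_congr_ae ?_).2 (Lp.memLp f')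
    refine ae_eq_of_integral_contDiff_smul_eq ?_
      ((Lp.memLp f').locallyIntegrable (by norm_num)) fun u hu hus => ?_
    · have h1 := (Lp.memLp (𝓕 w : L2line)).locallyIntegrable (by norm_num)
      rw [← locallyIntegrableOn_univ] at h1 ⊢
      exact h1.continuousOn_mul htg.1.continuous.continuousOn isOpen_univ.isLocallyClosed
    · have hus' : HasCompactSupport (fun x => (u x : ℂ)) :=
        hus.comp_left (g := ((↑) : ℝ → ℂ)) Complex.ofReal_zero
      have e := congrArg (fun T : 𝓢'(ℝ, ℂ) =>
        T (hus'.toSchwartzMap (Complex.ofRealCLM.contDiff.comp hu))) hf'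
      simp only [key, Lp.toTemperedDistribution_apply] at e
      exact e
  · intro h
    refine ⟨h.toLp _, ?_⟩
    ext u
    rw [key, Lp.toTemperedDistribution_apply]
    refine integral_congr_ae ?_
    filter_upwards [h.coeFn_toLp] with x hx
    rw [hx]

theorem one_add_sq_le (η : ℝ) : 1 + (2 * Real.pi * η) ^ 2 ≤ 7 ^ 2 * (1 + ‖η‖ ^ 2) := by
  have := Real.pi_lt_d2
  have := Real.pi_pos
  rw [Real.norm_eq_abs, sq_abs, mul_pow]
  have : (2 * Real.pi) ^ 2 ≤ 7 ^ 2 := by gcongr; linarith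
  nlinarith [sq_nonneg η]

theorem le_one_add_sq (η : ℝ) : 1 + ‖η‖ ^ 2 ≤ 1 + (2 * Real.pi * η) ^ 2 := by
  have := Real.pi_gt_three
  rw [Real.norm_eq_abs, sq_abs, mul_pow]
  have : 1 ≤ (2 * Real.pi) ^ 2 := by nlinarith
  nlinarith [sq_nonneg η]

theorem memLp_logWeight {p : ℝ} (hp : 0 < p) {f : L2pos} (hf : MemHp p (vTransform f)) :
    MemLp (fun η : ℝ => ((logWeight η ^ p : ℝ) : ℂ) * fourierV f η) 2 volume := by
  rw [memHp_iff] at hf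
  refine hf.of_le_mul (c := 5 ^ p * 7 ^ p) ?_ (Eventually.of_forall fun η => ?_)
  · refine AEStronglyMeasurable.mul ?_ (Lp.aestronglyMeasurable _)
    exact (Complex.continuous_ofReal.comp (continuous_logWeight.rpow_const
      fun η => Or.inl (logWeight_pos η).ne')).aestronglyMeasurable
  · rw [norm_mul, norm_mul, Complex.norm_real, Complex.norm_real, ← mul_assoc,
      Real.norm_of_nonneg (Real.rpow_nonneg (logWeight_pos η).le _),
      Real.norm_of_nonneg (by positivity)]
    refine mul_le_mul_of_nonneg_right ?_ (norm_nonneg _)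
    refine (logWeight_rpow_le hp η).trans ?_
    rw [mul_assoc (5 ^ p)]
    refine mul_le_mul_of_nonneg_left ?_ (by positivity)
    have h7 : (7 : ℝ) ^ p * (1 + ‖η‖ ^ 2) ^ (p / 2) = (7 ^ 2 * (1 + ‖η‖ ^ 2)) ^ (p / 2) := by
      rw [Real.mul_rpow (by norm_num) (by positivity), rpow_half_eq p (7 ^ 2) (by norm_num),
        Real.sqrt_sq (by norm_num)]
    rw [h7]
    exact Real.rpow_le_rpow (by positivity) (one_add_sq_le η) (by positivity)

theorem memHp_source {p : ℝ} (hp : 0 < p) (w : L2pos) :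
    MemHp p (vTransform (logSourceOp p w)) := by
  rw [memHp_iff, ← fourierV_apply, logSourceOp_eq hp]
  refine (Lp.memLp (fourierV w)).of_le_mul (c := 2 ^ p) ?_ ?_
  · refine AEStronglyMeasurable.mul ?_ (Lp.aestronglyMeasurable _)
    refine Continuous.aestronglyMeasurable (Complex.continuous_ofReal.comp ?_)
    exact Continuous.rpow_const (by fun_prop) fun η => Or.inl (by positivity)
  · filter_upwards [fourierV_multHom_ae (sourceBCF hp) w] with η hη
    rw [hη, sourceBCF_apply, norm_mul, norm_mul, Complex.norm_real, Complex.norm_real, ← mul_assoc,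
      Real.norm_of_nonneg (sourceSymbol_pos p η).le, Real.norm_of_nonneg (by positivity)]
    refine mul_le_mul_of_nonneg_right ?_ (norm_nonneg _)
    calc _ ≤ 2 ^ p * logWeight η ^ p * sourceSymbol p η := by
          refine mul_le_mul_of_nonneg_right (le_trans ?_ (hpWeight_le hp η))
            (sourceSymbol_pos p η).le
          exact Real.rpow_le_rpow (by positivity) (le_one_add_sq η) (by positivity)
      _ = 2 ^ p := by
          rw [mul_assoc, mul_comm (logWeight η ^ p), sourceSymbol_mul_rpow, mul_one]

theorem logSourceOp_injective {p : ℝ} (hp : 0 < p) : Function.Injective (logSourceOp p) := by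
  intro w w' h
  rw [logSourceOp_eq hp] at h
  refine fourierV.injective (Lp.ext ?_)
  have h' := fourierV_multHom_ae (sourceBCF hp) w
  rw [h] at h'
  filter_upwards [h', fourierV_multHom_ae (sourceBCF hp) w'] with η h1 h2
  rw [h1] at h2
  refine mul_left_cancel₀ ?_ h2
  rw [sourceBCF_apply]
  exact_mod_cast (sourceSymbol_pos p η).ne'

theorem exists_source {p : ℝ} (hp : 0 < p) {f : L2pos} (hf : MemHp p (vTransform f)) :
    ∃ w, f = logSourceOp p w := by
  -- The source is obtained by dividing by the symbol; Sobolev regularity is exactly what keeps the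
  -- quotient in `L²`.
  have hm := memLp_logWeight hp hf
  refine ⟨fourierV.symm (hm.toLp _), ?_⟩
  rw [logSourceOp_eq hp]
  refine fourierV.injective (Lp.ext ?_)
  filter_upwards [fourierV_multHom_ae (sourceBCF hp) (fourierV.symm (hm.toLp _)),
    hm.coeFn_toLp] with η h1 h2
  rw [h1, fourierV.apply_symm_apply, h2, sourceBCF_apply, ← mul_assoc, ← Complex.ofReal_mul,
    sourceSymbol_mul_rpow, Complex.ofReal_one, one_mul]

theorem toReal_eLpNorm_le_mul {f g : ℝ → ℂ} {C : ℝ} (hC : 0 ≤ C) (hg : MemLp g 2 volume)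
    (h : ∀ᵐ x, ‖f x‖ ≤ C * ‖g x‖) :
    (eLpNorm f 2 volume).toReal ≤ C * (eLpNorm g 2 volume).toReal := by
  have := eLpNorm_le_mul_eLpNorm_of_ae_le_mul h 2
  have h2 := ENNReal.toReal_mono (ENNReal.mul_ne_top ENNReal.ofReal_ne_top hg.2.ne) this
  rwa [ENNReal.toReal_mul, ENNReal.toReal_ofReal hC] at h2

theorem hpNorm_source_bounds {p : ℝ} (hp : 0 < p) (w : L2pos) :
    (5 ^ p)⁻¹ * ‖w‖ ≤ hpNorm p (vTransform (logSourceOp p w)) ∧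
      hpNorm p (vTransform (logSourceOp p w)) ≤ 2 ^ p * ‖w‖ := by
  have hae := fourierV_multHom_ae (sourceBCF hp) w
  rw [← logSourceOp_eq hp] at hae
  have hup : ∀ᵐ η : ℝ, ‖(((1 + (2 * Real.pi * η) ^ 2) ^ (p / 2) : ℝ) : ℂ) *
      fourierV (logSourceOp p w) η‖ ≤ 2 ^ p * ‖fourierV w η‖ := by
    filter_upwards [hae] with η hη
    rw [hη, sourceBCF_apply, norm_mul, norm_mul, Complex.norm_real, Complex.norm_real, ← mul_assoc,
      Real.norm_of_nonneg (sourceSymbol_pos p η).le, Real.norm_of_nonneg (by positivity)]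
    refine mul_le_mul_of_nonneg_right ?_ (norm_nonneg _)
    calc _ ≤ 2 ^ p * logWeight η ^ p * sourceSymbol p η :=
          mul_le_mul_of_nonneg_right (hpWeight_le hp η) (sourceSymbol_pos p η).le
      _ = 2 ^ p := by
          rw [mul_assoc, mul_comm (logWeight η ^ p), sourceSymbol_mul_rpow, mul_one]
  have hlow : ∀ᵐ η : ℝ, ‖fourierV w η‖ ≤ 5 ^ p * ‖(((1 + (2 * Real.pi * η) ^ 2) ^ (p / 2) : ℝ) : ℂ) *
      fourierV (logSourceOp p w) η‖ := by
    filter_upwards [hae] with η hη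
    rw [hη, sourceBCF_apply, norm_mul, norm_mul, Complex.norm_real, Complex.norm_real, ← mul_assoc,
      ← mul_assoc, Real.norm_of_nonneg (sourceSymbol_pos p η).le,
      Real.norm_of_nonneg (by positivity)]
    refine le_mul_of_one_le_left (norm_nonneg _) ?_
    calc (1 : ℝ) = logWeight η ^ p * sourceSymbol p η := by
          rw [mul_comm, sourceSymbol_mul_rpow]
      _ ≤ _ := mul_le_mul_of_nonneg_right (logWeight_rpow_le hp η) (sourceSymbol_pos p η).le
  have hm : MemLp (fun η : ℝ => (((1 + (2 * Real.pi * η) ^ 2) ^ (p / 2) : ℝ) : ℂ) *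
      fourierV (logSourceOp p w) η) 2 volume := by
    refine (Lp.memLp (fourierV w)).of_le_mul ?_ hup
    refine AEStronglyMeasurable.mul ?_ (Lp.aestronglyMeasurable _)
    refine Continuous.aestronglyMeasurable (Complex.continuous_ofReal.comp ?_)
    exact Continuous.rpow_const (by fun_prop) fun η => Or.inl (by positivity)
  have h1 := toReal_eLpNorm_le_mul (by positivity) (Lp.memLp (fourierV w)) hup
  have h2 := toReal_eLpNorm_le_mul (by positivity) hm hlow
  rw [← Lp.norm_def, fourierV.norm_map] at h1 h2
  rw [inv_mul_le_iff₀ (by positivity)]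
  exact ⟨h2, h1⟩

/-! ### Quadratic minimization -/

section Quadratic

variable {H K₁ K₂ : Type*} [NormedAddCommGroup H] [InnerProductSpace ℂ H] [CompleteSpace H]
  [NormedAddCommGroup K₁] [InnerProductSpace ℂ K₁] [CompleteSpace K₁]
  [NormedAddCommGroup K₂] [InnerProductSpace ℂ K₂] [CompleteSpace K₂]

open ContinuousLinearMap in
/-- The expansion of the Tikhonov functional around a solution of the normal equation. -/
theorem tikhonov_expansion (A : H →L[ℂ] K₁) (B : H →L[ℂ] K₂) {γ : K₁} {h₀ : H}
    (h : (adjoint A ∘L A + adjoint B ∘L B) h₀ = adjoint A γ) (d : H) :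
    ‖γ - A (h₀ + d)‖ ^ 2 + ‖B (h₀ + d)‖ ^ 2 =
      ‖γ - A h₀‖ ^ 2 + ‖B h₀‖ ^ 2 + (‖A d‖ ^ 2 + ‖B d‖ ^ 2) := by
  have e1 : γ - A (h₀ + d) = (γ - A h₀) - A d := by rw [map_add]; abel
  have e2 : B (h₀ + d) = B h₀ + B d := map_add _ _ _
  -- The normal equation in weak form; it makes the two cross terms cancel.
  have e3 : inner ℂ (B h₀) (B d) = inner ℂ (γ - A h₀) (A d) := by
    rw [← adjoint_inner_left, ← adjoint_inner_left, map_sub, ← h]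
    simp
  rw [e1, e2, norm_sub_sq (𝕜 := ℂ), norm_add_sq (𝕜 := ℂ), e3]
  ring

open ContinuousLinearMap in
theorem tikhonov_minimizer_iff (A : H →L[ℂ] K₁) (B : H →L[ℂ] K₂) {S : H →L[ℂ] H}
    (hS : (adjoint A ∘L A + adjoint B ∘L B) * S = 1)
    (hS' : S * (adjoint A ∘L A + adjoint B ∘L B) = 1) (γ : K₁) (h : H) :
    (∀ h', ‖γ - A h‖ ^ 2 + ‖B h‖ ^ 2 ≤ ‖γ - A h'‖ ^ 2 + ‖B h'‖ ^ 2) ↔ h = S (adjoint A γ) := by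
  have h0 : (adjoint A ∘L A + adjoint B ∘L B) (S (adjoint A γ)) = adjoint A γ :=
    congrArg (fun T : H →L[ℂ] H => T (adjoint A γ)) hS
  have key := tikhonov_expansion A B h0
  constructor
  · intro hmin
    have h1 := hmin (S (adjoint A γ))
    have h2 := key (h - S (adjoint A γ))
    rw [add_sub_cancel] at h2
    set d := h - S (adjoint A γ) with hd
    have hA : ‖A d‖ = 0 := by
      have : ‖A d‖ ^ 2 = 0 := by nlinarith [sq_nonneg ‖A d‖, sq_nonneg ‖B d‖]
      exact pow_eq_zero_iff two_ne_zero |>.1 this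
    have hB : ‖B d‖ = 0 := by
      have : ‖B d‖ ^ 2 = 0 := by nlinarith [sq_nonneg ‖A d‖, sq_nonneg ‖B d‖]
      exact pow_eq_zero_iff two_ne_zero |>.1 this
    rw [norm_eq_zero] at hA hB
    -- A competing minimizer differs by a vector killed by both operators, hence by the invertible
    -- normal operator.
    have hT : (adjoint A ∘L A + adjoint B ∘L B) d = 0 := by simp [hA, hB]
    have hd0 : d = S ((adjoint A ∘L A + adjoint B ∘L B) d) :=
      (congrArg (fun T : H →L[ℂ] H => T d) hS').symm
    rw [hT, map_zero] at hd0
    rwa [hd, sub_eq_zero] at hd0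
  · rintro rfl h'
    have h2 := key (h' - S (adjoint A γ))
    rw [add_sub_cancel] at h2
    rw [h2]
    exact le_add_of_nonneg_right (by positivity)

end Quadratic

/-! ### The symbol of `I - C_β` -/

/-- The defect `1 - √(2π) φ̂(ξ)`. -/
def defect (φ : ℝ → ℝ) (ξ : ℝ) : ℝ := 1 - √(2 * Real.pi) * (fourierHat φ ξ).re

theorem sqrt_two_pi_pos : 0 < √(2 * Real.pi) := Real.sqrt_pos.2 (by positivity)

theorem fourier_eq_fourierHat (φ : ℝ → ℝ) (η : ℝ) :
    𝓕 (fun t => (φ t : ℂ)) η = √(2 * Real.pi) * fourierHat φ (2 * Real.pi * η) := by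
  have h0 : (√(2 * Real.pi) : ℂ) ≠ 0 := by exact_mod_cast sqrt_two_pi_pos.ne'
  rw [fourierHat, ← mul_assoc, Complex.ofReal_div, Complex.ofReal_one, mul_one_div_cancel h0,
    one_mul, Real.fourier_real_eq_integral_exp_smul]
  refine integral_congr_ae (Eventually.of_forall fun t => ?_)
  simp only [smul_eq_mul]
  congr 2
  push_cast
  ring

theorem fourier_dilate (φ : ℝ → ℝ) {β : ℝ} (hβ : 0 < β) (η : ℝ) :
    𝓕 (fun t => (dilate φ β t : ℂ)) η = 𝓕 (fun t => (φ t : ℂ)) (β * η) := by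
  rw [Real.fourier_real_eq_integral_exp_smul, Real.fourier_real_eq_integral_exp_smul]
  have h := Measure.integral_comp_div
    (fun v : ℝ => Complex.exp (↑(-2 * Real.pi * v * (β * η)) * Complex.I) • (φ v : ℂ)) β
  have h2 : ∫ v : ℝ, Complex.exp (↑(-2 * Real.pi * v * (β * η)) * Complex.I) • (φ v : ℂ) =
      (1 / β : ℝ) • ∫ x : ℝ, Complex.exp (↑(-2 * Real.pi * (x / β) * (β * η)) * Complex.I) •
        (φ (x / β) : ℂ) := by
    rw [h, smul_smul, abs_of_pos hβ, one_div_mul_cancel hβ.ne', one_smul]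
  rw [h2, ← integral_smul]
  refine integral_congr_ae (Eventually.of_forall fun t => ?_)
  have e : -2 * Real.pi * (t / β) * (β * η) = -2 * Real.pi * t * η := by field_simp
  simp only [e, dilate, smul_eq_mul, Complex.real_smul]
  push_cast
  ring

namespace IsMollifier

variable {φ : ℝ → ℝ} {s : ℝ} (hφ : IsMollifier φ s)

include hφ

theorem one_sub_eq_defect (ξ : ℝ) :
    1 - (√(2 * Real.pi) : ℂ) * fourierHat φ ξ = defect φ ξ := by
  have e : fourierHat φ ξ = ((fourierHat φ ξ).re : ℂ) :=
    Complex.ext (by simp) (by simp [hφ.fourier_real ξ])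
  rw [e, defect]
  push_cast
  simp

theorem defect_zero : defect φ 0 = 0 := by
  have h := hφ.one_sub_eq_defect 0
  have e : fourierHat φ 0 = ((1 / √(2 * Real.pi) : ℝ) : ℂ) := by
    simp [fourierHat, integral_complex_ofReal, hφ.integral_eq_one]
  rw [e, ← Complex.ofReal_mul, mul_one_div_cancel sqrt_two_pi_pos.ne', Complex.ofReal_one,
    sub_self] at h
  exact_mod_cast h.symm

theorem defect_pos {ξ : ℝ} (hξ : ξ ≠ 0) : 0 < defect φ ξ := by
  have h := mul_lt_mul_of_pos_left (hφ.fourier_lt ξ hξ) sqrt_two_pi_pos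
  rw [mul_one_div_cancel sqrt_two_pi_pos.ne'] at h
  exact sub_pos.2 h

theorem defect_nonneg (ξ : ℝ) : 0 ≤ defect φ ξ := by
  rcases eq_or_ne ξ 0 with rfl | h
  · exact hφ.defect_zero.ge
  · exact (hφ.defect_pos h).le

theorem defect_mono {ξ η : ℝ} (h : |ξ| ≤ |η|) : defect φ ξ ≤ defect φ η :=
  sub_le_sub_left (mul_le_mul_of_nonneg_left (hφ.fourier_anti ξ η h) sqrt_two_pi_pos.le) _

theorem fourier_eq_one_sub_defect (η : ℝ) :
    𝓕 (fun t => (φ t : ℂ)) η = 1 - (defect φ (2 * Real.pi * η) : ℂ) := by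
  rw [← hφ.one_sub_eq_defect, fourier_eq_fourierHat]
  ring

/-- By the Riemann–Lebesgue lemma `φ̂` tends to `0` at infinity, so monotonicity in `|ξ|` forces `φ̂
≥ 0`. -/
theorem defect_le_one (ξ : ℝ) : defect φ ξ ≤ 1 := by
  have h1 : Tendsto (fun η : ℝ => ‖𝓕 (fun t => (φ t : ℂ)) η‖) atTop (𝓝 0) := by
    have := (Real.zero_at_infty_fourier (fun t => (φ t : ℂ))).mono_left atTop_le_cocompact
    simpa using this.norm
  refine le_of_forall_pos_le_add fun ε hε => ?_
  obtain ⟨η, h2, h3⟩ := ((h1.eventually_lt_const hε).and (eventually_ge_atTop |ξ|)).exists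
  rw [hφ.fourier_eq_one_sub_defect, ← Complex.ofReal_one, ← Complex.ofReal_sub,
    Complex.norm_real, Real.norm_eq_abs, abs_lt] at h2
  have h4 : |ξ| ≤ |2 * Real.pi * η| := by
    have hη : 0 ≤ η := (abs_nonneg ξ).trans h3
    rw [abs_of_nonneg (mul_nonneg Real.two_pi_pos.le hη)]
    refine h3.trans (le_mul_of_one_le_left hη ?_)
    linarith [Real.pi_gt_three]
  linarith [hφ.defect_mono h4]

theorem continuous_defect : Continuous (defect φ) := by
  have e : defect φ = fun ξ => 1 - (fourierBCF hφ.integrable (ξ / (2 * Real.pi))).re := by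
    funext ξ
    rw [fourierBCF_apply, hφ.fourier_eq_one_sub_defect, mul_div_cancel₀ _ (by positivity)]
    simp
  rw [e]
  have := (fourierBCF hφ.integrable).continuous
  fun_prop

theorem abs_defect_le (ξ : ℝ) : |defect φ ξ| ≤ 1 := by
  rw [abs_of_nonneg (hφ.defect_nonneg ξ)]
  exact hφ.defect_le_one ξ

/-- The symbol of `I - C_β`. -/
def defectBCF (β : ℝ) : ℝ →ᵇ ℂ :=
  realSymbol (fun η => defect φ (2 * Real.pi * β * η))
    (hφ.continuous_defect.comp (by fun_prop)) 1 fun η => hφ.abs_defect_le _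

theorem defectBCF_apply (β η : ℝ) :
    hφ.defectBCF β η = (defect φ (2 * Real.pi * β * η) : ℂ) := rfl

/-- The operator `(I - C_β) V`. -/
def residualOp (β : ℝ) : L2pos →L[ℂ] L2line :=
  vTransform.toContinuousLinearMap - mollifyOp hφ.integrable β ∘L vTransform.toContinuousLinearMap

theorem fourier_residualOp {β : ℝ} (hβ : 0 < β) (f : L2pos) :
    (𝓕 (hφ.residualOp β f) : L2line) = mulHom (hφ.defectBCF β) (fourierV f) := by
  have e : hφ.defectBCF β = 1 - fourierBCF (integrable_dilate hφ.integrable β) := by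
    ext η
    rw [defectBCF_apply, BoundedContinuousFunction.sub_apply, fourierBCF_apply, fourier_dilate _ hβ,
      hφ.fourier_eq_one_sub_defect, ← mul_assoc]
    change _ = (1 : ℂ) - _
    ring
  have h : (𝓕 (hφ.residualOp β f) : L2line) =
      fourierV f - 𝓕 (mollifyOp hφ.integrable β (vTransform f)) :=
    map_sub (Lp.fourierTransformₗᵢ ℝ ℂ) _ _
  rw [h, mollifyOp, fourier_kernelOp, e, map_sub, map_one]
  rfl

theorem adjoint_residualOp_comp {β : ℝ} (hβ : 0 < β) :
    ContinuousLinearMap.adjoint (hφ.residualOp β) ∘L hφ.residualOp β =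
      multHom (hφ.defectBCF β * hφ.defectBCF β) := by
  ext1 y
  refine ext_inner_left ℂ fun x => ?_
  rw [ContinuousLinearMap.comp_apply, ContinuousLinearMap.adjoint_inner_right,
    ← Lp.inner_fourier_eq, hφ.fourier_residualOp hβ, hφ.fourier_residualOp hβ,
    ← fourierV.inner_map_map, fourierV_multHom, L2.inner_def, L2.inner_def]
  refine integral_congr_ae ?_
  filter_upwards [mulHom_apply (hφ.defectBCF β) (fourierV x),
    mulHom_apply (hφ.defectBCF β) (fourierV y),
    mulHom_apply (hφ.defectBCF β * hφ.defectBCF β) (fourierV y)] with η h1 h2 h3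
  rw [h1, h2, h3, BoundedContinuousFunction.mul_apply, defectBCF_apply]
  simp only [RCLike.inner_apply, map_mul, Complex.conj_ofReal]
  ring

/-- The symbol of the normal operator `L* L + V* (I - C_β)² V`. -/
def _root_.RealLaplace.normalSymbol (φ : ℝ → ℝ) (β η : ℝ) : ℝ :=
  lapSymbol η + defect φ (2 * Real.pi * β * η) ^ 2

omit hφ in
theorem _root_.RealLaplace.normalSymbol_pos (φ : ℝ → ℝ) (β η : ℝ) : 0 < normalSymbol φ β η :=
  add_pos_of_pos_of_nonneg (lapSymbol_pos η) (sq_nonneg _)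

/-- The two summands are monotone in `|η|` in opposite directions: for `|η| ≤ 1` the Laplace part is
at least its value at `1`, for `|η| ≥ 1` the defect part is. -/
theorem exists_le_normalSymbol {β : ℝ} (hβ : 0 < β) : ∃ κ > 0, ∀ η, κ ≤ normalSymbol φ β η := by
  refine ⟨min (lapSymbol 1) (defect φ (2 * Real.pi * β * 1) ^ 2), lt_min (lapSymbol_pos 1) ?_,
    fun η => ?_⟩
  · exact pow_pos (hφ.defect_pos (by positivity)) 2
  rcases le_total |η| 1 with h | h
  · refine (min_le_left _ _).trans (le_add_of_le_of_nonneg ?_ (sq_nonneg _))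
    refine div_le_div_of_nonneg_left Real.pi_pos.le (Real.cosh_pos _) ?_
    rw [Real.cosh_le_cosh, abs_mul, abs_mul (2 * Real.pi ^ 2), abs_one]
    gcongr
  · refine (min_le_right _ _).trans (le_add_of_nonneg_of_le (lapSymbol_pos η).le ?_)
    refine pow_le_pow_left₀ (hφ.defect_nonneg _) (hφ.defect_mono ?_) 2
    rw [abs_mul, abs_mul (2 * Real.pi * β), abs_one]
    gcongr

theorem continuous_normalSymbol (β : ℝ) : Continuous (normalSymbol φ β) :=
  continuous_lapSymbol.add ((hφ.continuous_defect.comp (by fun_prop)).pow 2)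

theorem exists_inverse {β : ℝ} (hβ : 0 < β) :
    ∃ a : ℝ →ᵇ ℂ, ∀ η, a η = ((normalSymbol φ β η)⁻¹ : ℝ) := by
  obtain ⟨κ, hκ, h⟩ := hφ.exists_le_normalSymbol hβ
  refine ⟨realSymbol (fun η => (normalSymbol φ β η)⁻¹)
    ((hφ.continuous_normalSymbol β).inv₀ fun η => (normalSymbol_pos φ β η).ne') κ⁻¹ fun η => ?_,
    fun η => rfl⟩
  rw [abs_of_pos (inv_pos.2 (normalSymbol_pos φ β η))]
  exact inv_anti₀ hκ (h η)

theorem normalOp_eq {β : ℝ} (hβ : 0 < β) :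
    ContinuousLinearMap.adjoint laplaceOp ∘L laplaceOp +
      ContinuousLinearMap.adjoint (hφ.residualOp β) ∘L hφ.residualOp β =
      multHom (lapBCF + hφ.defectBCF β * hφ.defectBCF β) := by
  rw [adjoint_laplaceOp_comp, hφ.adjoint_residualOp_comp hβ, map_add]

theorem normalBCF_apply (β η : ℝ) :
    (lapBCF + hφ.defectBCF β * hφ.defectBCF β) η = (normalSymbol φ β η : ℂ) := by
  rw [BoundedContinuousFunction.add_apply, BoundedContinuousFunction.mul_apply, defectBCF_apply,
    lapBCF, realSymbol_apply, normalSymbol]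
  push_cast
  ring

theorem normalBCF_mul {β : ℝ} {a : ℝ →ᵇ ℂ}
    (ha : ∀ η, a η = ((normalSymbol φ β η)⁻¹ : ℝ)) :
    (lapBCF + hφ.defectBCF β * hφ.defectBCF β) * a = 1 := by
  ext η
  rw [BoundedContinuousFunction.mul_apply, normalBCF_apply, ha, ← Complex.ofReal_mul,
    mul_inv_cancel₀ (normalSymbol_pos φ β η).ne']
  simp

/-! ### Solving the normal equation by multipliers, and the error splitting. -/

theorem isMollifiedSolution_iff {β : ℝ} (hβ : 0 < β) {a : ℝ →ᵇ ℂ}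
    (ha : ∀ η, a η = ((normalSymbol φ β η)⁻¹ : ℝ)) (γ h : L2pos) :
    IsMollifiedSolution hφ.integrable β γ h ↔
      h = multHom a (ContinuousLinearMap.adjoint laplaceOp γ) := by
  refine tikhonov_minimizer_iff laplaceOp (hφ.residualOp β) (S := multHom a) ?_ ?_ γ h
  · rw [hφ.normalOp_eq hβ, ← map_mul, hφ.normalBCF_mul ha, map_one]
  · rw [hφ.normalOp_eq hβ, ← map_mul, mul_comm, hφ.normalBCF_mul ha, map_one]

theorem existsUnique_mollifiedSolution {β : ℝ} (hβ : 0 < β) (γ : L2pos) :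
    ∃! h, IsMollifiedSolution hφ.integrable β γ h := by
  obtain ⟨a, ha⟩ := hφ.exists_inverse hβ
  simp only [hφ.isMollifiedSolution_iff hβ ha]
  exact ⟨_, rfl, fun _ h => h⟩

-- Since `L*` is not a multiplier, the bound passes to the adjoint operator `L M_a`. Its squared
-- norm is a quadratic form with symbol `a m a`, which `adjoint_laplaceOp_comp` makes accessible.
omit hφ in
theorem _root_.RealLaplace.norm_multHom_adjoint_laplaceOp_le {a : ℝ →ᵇ ℂ} {r : ℝ → ℝ}
    (ha : ∀ η, a η = r η) {C : ℝ} (hC : 0 ≤ C) (h : ∀ η, lapSymbol η * r η ^ 2 ≤ C ^ 2)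
    (e : L2pos) : ‖multHom a (ContinuousLinearMap.adjoint laplaceOp e)‖ ≤ C * ‖e‖ := by
  have hadj : ContinuousLinearMap.adjoint (multHom a) = multHom a := by
    rw [← ContinuousLinearMap.star_eq_adjoint, ← map_star, (isSelfAdjoint_of_real ha).star_eq]
  have h1 : ‖laplaceOp ∘L multHom a‖ ≤ C := by
    refine ContinuousLinearMap.opNorm_le_bound _ hC fun x => ?_
    refine le_of_sq_le_sq ?_ (by positivity)
    have h2 : ‖laplaceOp (multHom a x)‖ ^ 2 = RCLike.re (inner ℂ x (multHom (a * lapBCF * a) x)) := by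
      have h5 := ContinuousLinearMap.adjoint_inner_left (multHom a)
        (multHom lapBCF (multHom a x)) x
      rw [hadj] at h5
      rw [← inner_self_eq_norm_sq (𝕜 := ℂ), inner_laplaceOp, map_mul, map_mul,
        mul_apply_eq_comp, mul_apply_eq_comp, h5]
    rw [ContinuousLinearMap.comp_apply, h2, mul_pow]
    refine (re_inner_le_norm _ _).trans ?_
    have h3 := norm_multHom_le (a * lapBCF * a) x (C := C ^ 2) fun η => by
      rw [BoundedContinuousFunction.mul_apply, BoundedContinuousFunction.mul_apply, ha, lapBCF,
        realSymbol_apply, ← Complex.ofReal_mul, ← Complex.ofReal_mul, Complex.norm_real,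
        Real.norm_of_nonneg]
      · refine le_trans (le_of_eq (by ring)) (h η)
      · have := lapSymbol_pos η
        nlinarith [mul_nonneg this.le (sq_nonneg (r η))]
    nlinarith [mul_le_mul_of_nonneg_left h3 (norm_nonneg x)]
  have h4 : multHom a (ContinuousLinearMap.adjoint laplaceOp e) =
      ContinuousLinearMap.adjoint (laplaceOp ∘L multHom a) e := by
    rw [ContinuousLinearMap.adjoint_comp, hadj]
    rfl
  rw [h4]
  refine (ContinuousLinearMap.le_opNorm _ _).trans ?_
  rw [LinearIsometryEquiv.norm_map]
  gcongr

/-- The error of the mollified solution splits into a bias and a noise term. -/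
theorem norm_sub_mollifiedSolution_le {p : ℝ} (hp : 0 < p) {β : ℝ} (hβ : 0 < β) {C₁ C₂ : ℝ}
    (hC₂ : 0 ≤ C₂)
    (h₁ : ∀ η, defect φ (2 * Real.pi * β * η) ^ 2 / normalSymbol φ β η * sourceSymbol p η ≤ C₁)
    (h₂ : ∀ η, lapSymbol η / normalSymbol φ β η ^ 2 ≤ C₂ ^ 2) {w gδ h : L2pos}
    (hh : IsMollifiedSolution hφ.integrable β gδ h) :
    ‖logSourceOp p w - h‖ ≤ C₁ * ‖w‖ + C₂ * ‖laplaceOp (logSourceOp p w) - gδ‖ := by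
  obtain ⟨a, ha⟩ := hφ.exists_inverse hβ
  rw [hφ.isMollifiedSolution_iff hβ ha] at hh
  set f := logSourceOp p w with hf
  -- The partition `1 = N⁻¹ m + N⁻¹ b²`: the first part reproduces the reconstruction from exact
  -- data, the second is the bias.
  have e1 : f = multHom a (multHom lapBCF f) +
      multHom a (multHom (hφ.defectBCF β * hφ.defectBCF β) f) := by
    rw [← map_add, ← add_apply, ← map_add, ← mul_apply_eq_comp, ← map_mul,
      mul_comm, hφ.normalBCF_mul ha, map_one]
    rfl
  have e2 : multHom lapBCF f = ContinuousLinearMap.adjoint laplaceOp (laplaceOp f) := by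
    rw [← adjoint_laplaceOp_comp]
    rfl
  have e3 : f - h = multHom (a * (hφ.defectBCF β * hφ.defectBCF β) * sourceBCF hp) w +
      multHom a (ContinuousLinearMap.adjoint laplaceOp (laplaceOp f - gδ)) := by
    rw [map_mul, mul_apply_eq_comp, ← logSourceOp_eq hp, ← hf, map_mul, mul_apply_eq_comp,
      map_sub, map_sub, ← e2, hh]
    nth_rewrite 1 [e1]
    abel
  rw [e3]
  refine (norm_add_le _ _).trans (add_le_add ?_ ?_)
  · refine norm_multHom_le _ _ fun η => ?_
    rw [BoundedContinuousFunction.mul_apply, BoundedContinuousFunction.mul_apply,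
      BoundedContinuousFunction.mul_apply, ha, defectBCF_apply, sourceBCF_apply,
      ← Complex.ofReal_mul, ← Complex.ofReal_mul, ← Complex.ofReal_mul, Complex.norm_real,
      Real.norm_of_nonneg]
    · refine le_trans (le_of_eq ?_) (h₁ η)
      rw [div_eq_mul_inv]
      ring
    · have := normalSymbol_pos φ β η
      have := sourceSymbol_pos p η
      have := hφ.defect_nonneg (2 * Real.pi * β * η)
      positivity
  · refine norm_multHom_adjoint_laplaceOp_le ha hC₂ (fun η => ?_) _
    rw [inv_pow, ← div_eq_mul_inv]
    exact h₂ η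

end IsMollifier

/-! ### The index function `Θ_p` -/

theorem neg_log_pos {t : ℝ} (ht : t ∈ Ioo (0 : ℝ) 1) : 0 < -Real.log t :=
  neg_pos.2 (Real.log_neg ht.1 ht.2)

theorem logFun_pos (p : ℝ) {t : ℝ} (ht : t ∈ Ioo (0 : ℝ) 1) : 0 < logFun p t :=
  Real.rpow_pos_of_pos (neg_log_pos ht) _

theorem Theta_pos (p : ℝ) {t : ℝ} (ht : t ∈ Ioo (0 : ℝ) 1) : 0 < Theta p t :=
  mul_pos (Real.sqrt_pos.2 ht.1) (logFun_pos p ht)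

theorem logFun_mono {p : ℝ} (hp : 0 < p) {t u : ℝ} (ht : 0 < t) (hu : u < 1) (htu : t ≤ u) :
    logFun p t ≤ logFun p u := by
  refine Real.rpow_le_rpow_of_nonpos (neg_log_pos ⟨ht.trans_le htu, hu⟩) ?_ (by linarith)
  exact neg_le_neg (Real.log_le_log ht htu)

theorem Theta_mono {p : ℝ} (hp : 0 < p) {t u : ℝ} (ht : 0 < t) (hu : u < 1) (htu : t ≤ u) :
    Theta p t ≤ Theta p u :=
  mul_le_mul (Real.sqrt_le_sqrt htu) (logFun_mono hp ht hu htu)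
    (logFun_pos p ⟨ht, htu.trans_lt hu⟩).le (Real.sqrt_nonneg _)

theorem exp_neg_one_mem_Ioo : Real.exp (-1) ∈ Ioo (0 : ℝ) 1 :=
  ⟨Real.exp_pos _, by simp⟩

theorem Theta_le_sqrt {p : ℝ} (hp : 0 < p) {t : ℝ} (ht : 0 < t) (ht1 : t ≤ Real.exp (-1)) :
    Theta p t ≤ √t := by
  have h := logFun_mono hp ht exp_neg_one_mem_Ioo.2 ht1
  have e : logFun p (Real.exp (-1)) = 1 := by simp [logFun]
  rw [e] at h
  exact mul_le_of_le_one_right (Real.sqrt_nonneg _) h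

/-- Intermediate value theorem. Small `y` suffice, since the inverse is used only as `δ ↓ 0`. -/
theorem exists_Theta_eq {p : ℝ} (hp : 0 < p) {y : ℝ} (hy : 0 < y)
    (hy' : y ≤ Theta p (Real.exp (-1))) : ∃ t ∈ Ioo (0 : ℝ) 1, Theta p t = y := by
  -- On `(0, e⁻¹]` one has `Θ_p(t) ≤ √t`, so `y²` is small enough for the left endpoint.
  set t₁ := min (y ^ 2) (Real.exp (-1)) with ht₁
  have h1 : 0 < t₁ := lt_min (by positivity) (Real.exp_pos _)
  have h2 : t₁ ≤ Real.exp (-1) := min_le_right _ _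
  have h3 : Theta p t₁ ≤ y := by
    refine (Theta_le_sqrt hp h1 h2).trans ?_
    rw [Real.sqrt_le_left hy.le]
    exact min_le_left _ _
  have hc : ContinuousOn (Theta p) (Icc t₁ (Real.exp (-1))) :=
    Real.continuous_sqrt.continuousOn.mul
      ((continuousOn_logFun hp).mono (Icc_subset_Icc_left h1.le))
  obtain ⟨t, ht, e⟩ := intermediate_value_Icc h2 hc ⟨h3, hy'⟩
  exact ⟨t, ⟨h1.trans_le ht.1, ht.2.trans_lt exp_neg_one_mem_Ioo.2⟩, e⟩

theorem ThetaInv_spec {p : ℝ} (hp : 0 < p) {y : ℝ} (hy : 0 < y)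
    (hy' : y ≤ Theta p (Real.exp (-1))) :
    ThetaInv p y ∈ Ioo (0 : ℝ) 1 ∧ Theta p (ThetaInv p y) = y := by
  have h := exists_Theta_eq hp hy hy'
  exact ⟨Function.invFunOn_mem h, Function.invFunOn_eq h⟩

theorem eventually_Theta_ThetaInv {p : ℝ} (hp : 0 < p) :
    ∀ᶠ y in 𝓝[>] (0 : ℝ), Theta p (ThetaInv p y) = y := by
  filter_upwards [Ioo_mem_nhdsGT (Theta_pos p exp_neg_one_mem_Ioo)] with y hy
  exact (ThetaInv_spec hp hy.1 hy.2.le).2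

theorem tendsto_ThetaInv {p : ℝ} (hp : 0 < p) : Tendsto (ThetaInv p) (𝓝[>] 0) (𝓝[>] 0) := by
  rw [(nhdsGT_basis (0 : ℝ)).tendsto_right_iff]
  intro ε hε
  set ε' := min ε (Real.exp (-1)) with hε'
  have h1 : ε' ∈ Ioo (0 : ℝ) 1 :=
    ⟨lt_min hε (Real.exp_pos _), (min_le_right _ _).trans_lt exp_neg_one_mem_Ioo.2⟩
  filter_upwards [Ioo_mem_nhdsGT (Theta_pos p exp_neg_one_mem_Ioo),
    Ioo_mem_nhdsGT (Theta_pos p h1)] with y hy hy'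
  obtain ⟨h2, h3⟩ := ThetaInv_spec hp hy.1 hy.2.le
  refine ⟨h2.1, lt_of_lt_of_le ?_ (min_le_left _ _ : ε' ≤ ε)⟩
  by_contra! h4
  have := Theta_mono hp h1.1 h2.2 h4
  rw [h3] at this
  exact absurd hy'.2 this.not_gt

/-! ### Bias and noise -/

/-- Positive powers of `t` beat all powers of `-ln t`; the smallness conditions on `t` below come
from here. -/
theorem eventually_rpow_mul_neg_log_le {a ε : ℝ} (ha : 0 < a) (hε : 0 < ε) (b : ℝ) :
    ∀ᶠ t in 𝓝[>] (0 : ℝ), t ^ a * (-Real.log t) ^ b ≤ ε := by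
  have h := (isLittleO_abs_log_rpow_rpow_nhdsGT_zero b (neg_lt_zero.2 ha)).bound hε
  filter_upwards [h, Ioo_mem_nhdsGT (zero_lt_one (α := ℝ))] with t h1 ht
  have hl := neg_log_pos ht
  rw [abs_of_neg (neg_pos.1 hl), Real.norm_of_nonneg (Real.rpow_nonneg hl.le _),
    Real.norm_of_nonneg (Real.rpow_nonneg ht.1.le _)] at h1
  calc t ^ a * (-Real.log t) ^ b ≤ t ^ a * (ε * t ^ (-a)) :=
        mul_le_mul_of_nonneg_left h1 (Real.rpow_nonneg ht.1.le _)
    _ = ε * (t ^ a * t ^ (-a)) := by ring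
    _ = ε := by rw [← Real.rpow_add ht.1, add_neg_cancel, Real.rpow_zero, mul_one]

theorem exp_neg_le_lapSymbol {η x : ℝ} (h : 2 * Real.pi ^ 2 * |η| ≤ x) :
    Real.exp (-x) ≤ lapSymbol η := by
  have h1 : Real.cosh (2 * Real.pi ^ 2 * η) ≤ Real.exp x := by
    rw [← Real.log_le_iff_le_exp (Real.cosh_pos _)]
    refine (log_cosh_le _).trans (le_trans (le_of_eq ?_) h)
    rw [abs_mul, abs_of_pos (by positivity : (0 : ℝ) < 2 * Real.pi ^ 2)]
  rw [lapSymbol, Real.exp_neg, le_div_iff₀ (Real.cosh_pos _), inv_mul_le_iff₀ (Real.exp_pos _)]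
  have := Real.exp_pos x
  nlinarith [Real.pi_gt_three]

theorem lapSymbol_le_exp (η : ℝ) : lapSymbol η ≤ 2 * Real.pi * Real.exp (-(2 * Real.pi ^ 2 * η)) := by
  have h := Real.cosh_eq (2 * Real.pi ^ 2 * η)
  have h2 := Real.exp_pos (-(2 * Real.pi ^ 2 * η))
  rw [lapSymbol, Real.exp_neg, div_le_iff₀ (Real.cosh_pos _), ← div_eq_mul_inv, div_mul_eq_mul_div,
    le_div_iff₀ (Real.exp_pos _)]
  have h3 : Real.exp (2 * Real.pi ^ 2 * η) ≤ 2 * Real.cosh (2 * Real.pi ^ 2 * η) := by linarith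
  linarith [mul_le_mul_of_nonneg_left h3 Real.pi_pos.le]

namespace IsMollifier

variable {φ : ℝ → ℝ} {s : ℝ} (hφ : IsMollifier φ s)

include hφ

theorem exists_defect_bounds (hs : 0 < s) : ∃ ε > 0, ∀ ξ, |ξ| ≤ ε →
    |ξ| ^ s / 2 ≤ defect φ ξ ∧ defect φ ξ ≤ 2 * |ξ| ^ s := by
  have h := hφ.fourier_equiv.isLittleO.bound (one_half_pos (α := ℝ))
  rw [eventually_nhdsWithin_iff, Metric.eventually_nhds_iff] at h
  obtain ⟨ε, hε, h⟩ := h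
  refine ⟨ε / 2, half_pos hε, fun ξ hξ => ?_⟩
  rcases eq_or_ne ξ 0 with rfl | h0
  · rw [hφ.defect_zero, abs_zero, Real.zero_rpow hs.ne']
    simp
  have h1 := h (y := ξ) (by rw [dist_zero_right, Real.norm_eq_abs]; linarith) h0
  have h2 : 0 ≤ |ξ| ^ s := Real.rpow_nonneg (abs_nonneg _) _
  rw [Pi.sub_apply, hφ.one_sub_eq_defect, Complex.norm_real,
    Real.norm_of_nonneg (hφ.defect_nonneg ξ), Real.norm_of_nonneg h2, Real.norm_eq_abs, abs_le] at h1
  constructor <;> linarith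

/-- For `|η| ≤ 1` the quotient is at most `1/m(η) ≤ 1/m(1)`, which is harmless. For `|η| ≥ 1`, `(m +
b²)² ≥ 4 m b²`, and monotonicity of the defect gives `b² ≥ β^{2s}/4 = t/4`. -/
theorem eventually_noise_le (hs : 0 < s) : ∃ C > 0, ∀ᶠ t in 𝓝[>] (0 : ℝ), ∀ η,
    lapSymbol η / normalSymbol φ (t ^ (1 / (2 * s))) η ^ 2 ≤ (C / √t) ^ 2 := by
  obtain ⟨ε, hε, hb⟩ := hφ.exists_defect_bounds hs
  have hκ := lapSymbol_pos 1
  refine ⟨√(1 + (lapSymbol 1)⁻¹), by positivity, ?_⟩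
  have ha : 0 < 1 / (2 * s) := by positivity
  -- Log exponent `0`: this only says `2πβ ≤ ε`, so that the defect bounds apply at `2πβ`.
  have hev := eventually_rpow_mul_neg_log_le ha (show 0 < ε / (2 * Real.pi) by positivity) 0
  filter_upwards [hev, Ioo_mem_nhdsGT (zero_lt_one (α := ℝ))] with t h1 ht η
  have ht0 := ht.1
  set β := t ^ (1 / (2 * s)) with hβ
  have hβ0 : 0 < β := Real.rpow_pos_of_pos ht0 _
  rw [Real.rpow_zero, mul_one, le_div_iff₀ (by positivity)] at h1
  have hβs : (β ^ s) ^ 2 = t := by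
    rw [hβ, ← Real.rpow_mul ht0.le, ← Real.rpow_natCast, ← Real.rpow_mul ht0.le]
    have : 1 / (2 * s) * s * ((2 : ℕ) : ℝ) = 1 := by push_cast; field_simp
    rw [this, Real.rpow_one]
  rw [div_pow, Real.sq_sqrt (by positivity), Real.sq_sqrt ht0.le]
  have hN := normalSymbol_pos φ β η
  have hm := lapSymbol_pos η
  set b := defect φ (2 * Real.pi * β * η) with hbdef
  have hNe : normalSymbol φ β η = lapSymbol η + b ^ 2 := rfl
  rcases le_total |η| 1 with h | h
  · have hm1 : lapSymbol 1 ≤ lapSymbol η := by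
      refine div_le_div_of_nonneg_left Real.pi_pos.le (Real.cosh_pos _) ?_
      rw [Real.cosh_le_cosh, abs_mul, abs_mul (2 * Real.pi ^ 2), abs_one]
      gcongr
    calc lapSymbol η / normalSymbol φ β η ^ 2 ≤ lapSymbol η / lapSymbol η ^ 2 := by
          gcongr
          rw [hNe]
          exact le_add_of_nonneg_right (sq_nonneg b)
      _ = (lapSymbol η)⁻¹ := by field_simp
      _ ≤ (lapSymbol 1)⁻¹ := inv_anti₀ hκ hm1
      _ ≤ 1 + (lapSymbol 1)⁻¹ := by linarith
      _ ≤ (1 + (lapSymbol 1)⁻¹) / t := le_div_self (by positivity) ht0 ht.2.le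
  · have hb1 : β ^ s / 2 ≤ b := by
      have h2 := (hb (2 * Real.pi * β) (by rw [abs_of_pos (by positivity)]; linarith)).1
      rw [abs_of_pos (by positivity)] at h2
      have h3 : β ^ s ≤ (2 * Real.pi * β) ^ s := by
        refine Real.rpow_le_rpow hβ0.le (le_mul_of_one_le_left hβ0.le ?_) hs.le
        linarith [Real.pi_gt_three]
      have h4 : defect φ (2 * Real.pi * β) ≤ b := by
        refine hφ.defect_mono ?_
        rw [abs_mul (2 * Real.pi * β)]
        exact le_mul_of_one_le_right (abs_nonneg _) h
      linarith
    have hb2 : t / 4 ≤ b ^ 2 := by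
      have h5 : (β ^ s / 2) ^ 2 ≤ b ^ 2 := pow_le_pow_left₀ (by positivity) hb1 2
      rw [div_pow, hβs] at h5
      linarith
    calc lapSymbol η / normalSymbol φ β η ^ 2 ≤ 1 / t := by
          rw [div_le_div_iff₀ (by positivity) ht0, hNe]
          nlinarith [sq_nonneg (lapSymbol η - b ^ 2), mul_le_mul_of_nonneg_left hb2 hm.le]
      _ ≤ (1 + (lapSymbol 1)⁻¹) / t := by
          gcongr
          have := inv_pos.2 hκ
          linarith

/-- Frequencies are split at `2π²|η| = l/2`, where `l = -ln t`. Above, `b²/N ≤ 1` and the source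
symbol is at most `(l/2)^{-p}`. Below, `m ≥ e^{-l/2} = √t` while `b²` is at most `4 t l^{2s}`, so
`b²/N` is smaller than any power of `1/l` requires. -/
theorem eventually_bias_le (hs : 0 < s) {p : ℝ} (hp : 0 < p) : ∀ᶠ t in 𝓝[>] (0 : ℝ), ∀ η,
    defect φ (2 * Real.pi * t ^ (1 / (2 * s)) * η) ^ 2 / normalSymbol φ (t ^ (1 / (2 * s))) η *
      sourceSymbol p η ≤ 2 ^ p * logFun p t := by
  obtain ⟨ε, hε, hb⟩ := hφ.exists_defect_bounds hs
  have ha : 0 < 1 / (2 * s) := by positivity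
  -- The first condition is `β l ≤ ε`, placing the low frequencies where the defect bounds hold. The
  -- second, `√t l^{2s+p} ≤ 1/4`, cancels the factor `4` in the bound for `b²`.
  filter_upwards [eventually_rpow_mul_neg_log_le ha hε 1,
    eventually_rpow_mul_neg_log_le (one_half_pos (α := ℝ)) (show (0 : ℝ) < 1 / 4 by norm_num)
      (2 * s + p), Ioo_mem_nhdsGT (zero_lt_one (α := ℝ))] with t h1 h2 ht η
  have ht0 := ht.1
  set l := -Real.log t with hl
  have hl0 : 0 < l := neg_log_pos ht
  set β := t ^ (1 / (2 * s)) with hβ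
  have hβ0 : 0 < β := Real.rpow_pos_of_pos ht0 _
  rw [Real.rpow_one] at h1
  have hβs : (β ^ s) ^ 2 = t := by
    rw [hβ, ← Real.rpow_mul ht0.le, ← Real.rpow_natCast, ← Real.rpow_mul ht0.le]
    have : 1 / (2 * s) * s * ((2 : ℕ) : ℝ) = 1 := by push_cast; field_simp
    rw [this, Real.rpow_one]
  have hN := normalSymbol_pos φ β η
  have hm := lapSymbol_pos η
  set b := defect φ (2 * Real.pi * β * η) with hbdef
  have hb0 : 0 ≤ b := hφ.defect_nonneg _
  have hNe : normalSymbol φ β η = lapSymbol η + b ^ 2 := rfl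
  have hω := sourceSymbol_pos p η
  have h2p : (1 : ℝ) ≤ 2 ^ p := Real.one_le_rpow (by norm_num) hp.le
  change _ ≤ 2 ^ p * l ^ (-p)
  rcases le_total (l / 2) (2 * Real.pi ^ 2 * |η|) with h | h
  · have e1 : b ^ 2 / normalSymbol φ β η ≤ 1 := by
      rw [div_le_one hN, hNe]
      linarith
    calc _ ≤ 1 * sourceSymbol p η := mul_le_mul_of_nonneg_right e1 hω.le
      _ ≤ (l / 2) ^ (-p) := by
          rw [one_mul]
          exact Real.rpow_le_rpow_of_nonpos (by positivity) (h.trans (abs_le_logWeight η))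
            (by linarith)
      _ = 2 ^ p * l ^ (-p) := by
          rw [Real.div_rpow hl0.le (by norm_num), Real.rpow_neg (by norm_num : (0 : ℝ) ≤ 2),
            div_inv_eq_mul, mul_comm]
  · have hx : |2 * Real.pi * β * η| ≤ β * l := by
      have e : |2 * Real.pi * β * η| = β * (2 * Real.pi * |η|) := by
        rw [abs_mul, abs_of_pos (by positivity)]
        ring
      rw [e]
      refine mul_le_mul_of_nonneg_left ?_ hβ0.le
      have h3 : 0 ≤ Real.pi * |η| := by positivity
      nlinarith [Real.pi_gt_three]
    have hb1 : b ≤ 2 * (β ^ s * l ^ s) := by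
      refine (hb _ (hx.trans h1)).2.trans ?_
      rw [← Real.mul_rpow hβ0.le hl0.le]
      gcongr
    have hl2 : (l ^ s) ^ 2 = l ^ (2 * s) := by
      rw [← Real.rpow_natCast, ← Real.rpow_mul hl0.le]
      congr 1
      push_cast
      ring
    have hb2 : b ^ 2 ≤ 4 * t * l ^ (2 * s) := by
      refine (pow_le_pow_left₀ hb0 hb1 2).trans (le_of_eq ?_)
      rw [mul_pow, mul_pow, hβs, hl2]
      ring
    have hsq : t ^ (1 / 2 : ℝ) * t ^ (1 / 2 : ℝ) = t := by
      rw [← Real.rpow_add ht0]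
      norm_num
    have hm1 : t ^ (1 / 2 : ℝ) ≤ normalSymbol φ β η := by
      have h3 := exp_neg_le_lapSymbol h
      have e : Real.exp (-(l / 2)) = t ^ (1 / 2 : ℝ) := by
        rw [Real.rpow_def_of_pos ht0, hl]
        congr 1
        ring
      rw [e] at h3
      rw [hNe]
      exact h3.trans (le_add_of_nonneg_right (sq_nonneg b))
    have ht2 : 0 < t ^ (1 / 2 : ℝ) := Real.rpow_pos_of_pos ht0 _
    have e1 : b ^ 2 / normalSymbol φ β η ≤ l ^ (-p) := by
      rw [Real.rpow_add hl0] at h2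
      have hlp := Real.rpow_pos_of_pos hl0 p
      have hlp' := Real.rpow_pos_of_pos hl0 (2 * s)
      rw [Real.rpow_neg hl0.le, div_le_iff₀ hN, ← div_eq_inv_mul, le_div_iff₀ hlp]
      calc b ^ 2 * l ^ p ≤ 4 * t * l ^ (2 * s) * l ^ p := by gcongr
        _ = 4 * (t ^ (1 / 2 : ℝ) * (l ^ (2 * s) * l ^ p)) * t ^ (1 / 2 : ℝ) := by
            nth_rewrite 1 [← hsq]
            ring
        _ ≤ 4 * (1 / 4) * t ^ (1 / 2 : ℝ) := by gcongr
        _ ≤ normalSymbol φ β η := by linarith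
    calc _ ≤ l ^ (-p) * 1 := mul_le_mul e1 (sourceSymbol_le_one hp η) hω.le (by positivity)
      _ ≤ 2 ^ p * l ^ (-p) := by
          rw [mul_one]
          exact le_mul_of_one_le_left (by positivity) h2p

end IsMollifier

/-- For small `t` one has `t ≤ Θ_p(t)`, hence `-ln Θ_p(t)² ≤ 2(-ln t)`: the two arguments differ by
a factor in the logarithm, which costs only `2^p`. -/
theorem eventually_logFun_le {p : ℝ} (hp : 0 < p) : ∀ᶠ t in 𝓝[>] (0 : ℝ),
    Theta p t < 1 → logFun p t ≤ 2 ^ p * logFun p (Theta p t ^ 2) := by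
  filter_upwards [eventually_rpow_mul_neg_log_le (one_half_pos (α := ℝ)) zero_lt_one p,
    Ioo_mem_nhdsGT (zero_lt_one (α := ℝ))] with t h1 ht hΘ
  have hl := neg_log_pos ht
  have hpos := Theta_pos p ht
  have h2 : t ≤ Theta p t := by
    rw [Theta, logFun, Real.rpow_neg hl.le, ← div_eq_mul_inv,
      le_div_iff₀ (Real.rpow_pos_of_pos hl p)]
    rw [← Real.sqrt_eq_rpow] at h1
    calc t * (-Real.log t) ^ p = √t * (√t * (-Real.log t) ^ p) := by
          rw [← mul_assoc, Real.mul_self_sqrt ht.1.le]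
      _ ≤ √t := mul_le_of_le_one_right (Real.sqrt_nonneg _) h1
  have h3 : -Real.log (Theta p t ^ 2) ≤ 2 * -Real.log t := by
    rw [Real.log_pow]
    push_cast
    linarith [Real.log_le_log ht.1 h2]
  have h4 : 0 < -Real.log (Theta p t ^ 2) :=
    neg_log_pos ⟨by positivity, pow_lt_one₀ hpos.le hΘ two_ne_zero⟩
  have h5 : (2 * -Real.log t) ^ (-p) ≤ logFun p (Theta p t ^ 2) :=
    Real.rpow_le_rpow_of_nonpos h4 h3 (by linarith)
  rw [Real.mul_rpow (by norm_num) hl.le, Real.rpow_neg (by norm_num), inv_mul_le_iff₀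
    (by positivity)] at h5
  exact h5

/-! ### The rate under the a priori rule. -/

theorem tendsto_div_nhdsGT {ρ : ℝ} (hρ : 0 < ρ) :
    Tendsto (fun δ : ℝ => δ / ρ) (𝓝[>] 0) (𝓝[>] 0) := by
  refine tendsto_nhdsWithin_iff.2 ⟨?_, ?_⟩
  · have : Tendsto (fun δ : ℝ => δ / ρ) (𝓝 0) (𝓝 (0 / ρ)) := tendsto_id.div_const ρ
    rw [zero_div] at this
    exact this.mono_left nhdsWithin_le_nhds
  · filter_upwards [self_mem_nhdsWithin] with δ hδ
    exact div_pos hδ hρ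

/-- The worst-case error of the mollified solution under the a priori rule. -/
theorem IsMollifier.exists_rate {φ : ℝ → ℝ} {s p : ℝ} (hφ : IsMollifier φ s) (hs : 0 < s)
    (hp : 0 < p) : ∃ K : ℝ, 0 < K ∧ ∀ ρ : ℝ, 0 < ρ → ∀ᶠ δ in 𝓝[>] (0 : ℝ), ∀ w gδ h : L2pos,
      ‖w‖ = ρ → ‖laplaceOp (logSourceOp p w) - gδ‖ ≤ δ →
      IsMollifiedSolution hφ.integrable (betaRule p s ρ δ) gδ h →
      ‖logSourceOp p w - h‖ ≤ K * ρ * logFun p (δ ^ 2 / ρ ^ 2) := by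
  obtain ⟨C, hC, hnoise⟩ := hφ.eventually_noise_le hs
  refine ⟨(2 ^ p + C) * 2 ^ p, by positivity, fun ρ hρ => ?_⟩
  have hlim := tendsto_div_nhdsGT hρ
  have hT := (tendsto_ThetaInv hp).comp hlim
  filter_upwards [hT.eventually hnoise, hT.eventually (hφ.eventually_bias_le hs hp),
    hT.eventually (eventually_logFun_le hp), hlim.eventually (eventually_Theta_ThetaInv hp),
    hlim.eventually (Ioo_mem_nhdsGT (zero_lt_one (α := ℝ))),
    hT.eventually (Ioo_mem_nhdsGT (zero_lt_one (α := ℝ)))]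
    with δ h1 h2 h3 h4 h5 h6 w gδ h hw hg hh
  simp only [Function.comp_apply] at h1 h2 h3 h6
  set t := ThetaInv p (δ / ρ) with ht
  rw [h4] at h3
  have ht0 : 0 < t := h6.1
  have h7 := hφ.norm_sub_mollifiedSolution_le hp (Real.rpow_pos_of_pos ht0 _)
    (div_nonneg hC.le (Real.sqrt_nonneg t)) h2 h1 hh (w := w)
  have h8 := h3 h5.2
  rw [div_pow] at h8
  -- The balance behind the rule: the noise term `δ/√t` becomes `ρ f_p(t)`, the size of the bias.
  have hδ : δ = ρ * (√t * logFun p t) := by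
    rw [← Theta, h4, mul_div_cancel₀ _ hρ.ne']
  calc ‖logSourceOp p w - h‖ ≤ 2 ^ p * logFun p t * ‖w‖ +
        C / √t * ‖laplaceOp (logSourceOp p w) - gδ‖ := h7
    _ ≤ 2 ^ p * logFun p t * ρ + C / √t * δ := by
        rw [hw]
        gcongr
    _ = (2 ^ p + C) * ρ * logFun p t := by
        have := Real.sqrt_pos.2 ht0
        nth_rewrite 1 [hδ]
        field_simp
    _ ≤ (2 ^ p + C) * ρ * (2 ^ p * logFun p (δ ^ 2 / ρ ^ 2)) := by gcongr
    _ = (2 ^ p + C) * 2 ^ p * ρ * logFun p (δ ^ 2 / ρ ^ 2) := by ring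

/-! ### The lower bound -/

theorem exists_concentrated {ρ : ℝ} (hρ : 0 < ρ) (a : ℝ) :
    ∃ w : L2pos, ‖w‖ = ρ ∧ ∀ᵐ η, η ∉ Icc a (a + 1) → fourierV w η = 0 := by
  refine ⟨fourierV.symm (indicatorConstLp 2 (measurableSet_Icc : MeasurableSet (Icc a (a + 1)))
    (by simp) (ρ : ℂ)), ?_, ?_⟩
  · rw [LinearIsometryEquiv.norm_map, norm_indicatorConstLp (by norm_num) (by norm_num),
      Complex.norm_real, Real.norm_of_nonneg hρ.le]
    simp
  · rw [LinearIsometryEquiv.apply_symm_apply]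
    exact indicatorConstLp_coeFn_notMem

theorem exists_bad_source {p : ℝ} (hp : 0 < p) {ρ δ : ℝ} (hρ : 0 < ρ) (hδ : 0 < δ)
    (hD : 1 + 4 * Real.pi ^ 2 ≤ -Real.log (δ ^ 2 / ρ ^ 2)) :
    ∃ w : L2pos, ‖w‖ = ρ ∧ ‖laplaceOp (logSourceOp p w)‖ ≤ δ ∧
      (2 ^ p)⁻¹ * ρ * logFun p (δ ^ 2 / ρ ^ 2) ≤ ‖logSourceOp p w‖ := by
  set y := δ ^ 2 / ρ ^ 2 with hy
  have hy0 : 0 < y := by positivity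
  set D := -Real.log y with hDdef
  have hpi2 : 0 < Real.pi ^ 2 := by positivity
  have hD0 : 0 < D := by linarith
  -- At `D/(2π²)` the factor `e^{-2π²η}` equals `δ²/ρ²`; the shift by `1` absorbs the prefactor `2π`
  -- of the symbol bound. On this interval the weight is at most `1 + D + 4π²`, which `hD` bounds by
  -- `2D`.
  obtain ⟨w, hw, hsupp⟩ := exists_concentrated hρ (D / (2 * Real.pi ^ 2) + 1)
  have hf := fourierV_multHom_ae (sourceBCF hp) w
  rw [← logSourceOp_eq hp] at hf
  refine ⟨w, hw, ?_, ?_⟩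
  · have hfn : ‖logSourceOp p w‖ ≤ ρ := by
      rw [logSourceOp_eq hp, ← hw]
      refine (norm_multHom_le (sourceBCF hp) w (C := 1) fun η => ?_).trans (one_mul _).le
      rw [sourceBCF_apply, Complex.norm_real]
      exact abs_sourceSymbol_le hp η
    have hL : ‖multHom lapBCF (logSourceOp p w)‖ ≤ y * ‖logSourceOp p w‖ := by
      rw [← fourierV.norm_map, ← fourierV.norm_map (logSourceOp p w)]
      refine Lp.norm_le_mul_norm_of_ae_le_mul ?_
      filter_upwards [fourierV_multHom_ae lapBCF (logSourceOp p w), hf, hsupp] with η h1 h2 h3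
      rw [h1, norm_mul]
      by_cases hη : η ∈ Icc (D / (2 * Real.pi ^ 2) + 1) (D / (2 * Real.pi ^ 2) + 1 + 1)
      · refine mul_le_mul_of_nonneg_right ?_ (norm_nonneg _)
        rw [lapBCF, realSymbol_apply, Complex.norm_real, Real.norm_of_nonneg (lapSymbol_pos η).le]
        refine (lapSymbol_le_exp η).trans ?_
        have h4 : D + 2 * Real.pi ^ 2 ≤ 2 * Real.pi ^ 2 * η := by
          have := mul_le_mul_of_nonneg_left hη.1 (by positivity : 0 ≤ 2 * Real.pi ^ 2)
          rwa [mul_add, mul_div_cancel₀ _ (by positivity), mul_one] at this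
        have h5 : Real.exp (-(2 * Real.pi ^ 2 * η)) ≤ y * Real.exp (-(2 * Real.pi ^ 2)) := by
          calc _ ≤ Real.exp (Real.log y + -(2 * Real.pi ^ 2)) := by
                rw [Real.exp_le_exp]
                linarith
            _ = _ := by rw [Real.exp_add, Real.exp_log hy0]
        have h6 : 2 * Real.pi * Real.exp (-(2 * Real.pi ^ 2)) ≤ 1 := by
          rw [Real.exp_neg, ← div_eq_mul_inv, div_le_one (Real.exp_pos _)]
          have := Real.add_one_le_exp (2 * Real.pi ^ 2)
          nlinarith [Real.pi_gt_three]
        calc _ ≤ 2 * Real.pi * (y * Real.exp (-(2 * Real.pi ^ 2))) := by gcongr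
          _ = y * (2 * Real.pi * Real.exp (-(2 * Real.pi ^ 2))) := by ring
          _ ≤ y := mul_le_of_le_one_right hy0.le h6
      · rw [h2, h3 hη]
        simp
    refine le_of_sq_le_sq ?_ hδ.le
    have h7 : ‖laplaceOp (logSourceOp p w)‖ ^ 2 =
        RCLike.re (inner ℂ (logSourceOp p w) (multHom lapBCF (logSourceOp p w))) := by
      rw [← inner_self_eq_norm_sq (𝕜 := ℂ), inner_laplaceOp]
    have h0 := norm_nonneg (logSourceOp p w)
    calc _ ≤ ‖logSourceOp p w‖ * ‖multHom lapBCF (logSourceOp p w)‖ := by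
          rw [h7]
          exact re_inner_le_norm _ _
      _ ≤ ρ * (y * ρ) := by
          refine mul_le_mul hfn (hL.trans ?_) (norm_nonneg _) hρ.le
          gcongr
      _ = δ ^ 2 := by
          rw [hy]
          field_simp
  · have h1 : ‖w‖ ≤ (2 * D) ^ p * ‖logSourceOp p w‖ := by
      rw [← fourierV.norm_map, ← fourierV.norm_map (logSourceOp p w)]
      refine Lp.norm_le_mul_norm_of_ae_le_mul ?_
      filter_upwards [hf, hsupp] with η h2 h3
      by_cases hη : η ∈ Icc (D / (2 * Real.pi ^ 2) + 1) (D / (2 * Real.pi ^ 2) + 1 + 1)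
      · rw [h2, norm_mul, sourceBCF_apply, Complex.norm_real,
          Real.norm_of_nonneg (sourceSymbol_pos p η).le, ← mul_assoc]
        refine le_mul_of_one_le_left (norm_nonneg _) ?_
        have hη0 : 0 ≤ η := le_trans (by positivity) hη.1
        have h4 : logWeight η ≤ 2 * D := by
          have h5 := logWeight_le η
          rw [abs_of_nonneg hη0] at h5
          have h6 := mul_le_mul_of_nonneg_left hη.2 (by positivity : 0 ≤ 2 * Real.pi ^ 2)
          rw [mul_add, mul_add, mul_div_cancel₀ _ (by positivity), mul_one] at h6
          linarith
        rw [← sourceSymbol_mul_rpow p η, mul_comm]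
        exact mul_le_mul_of_nonneg_right (Real.rpow_le_rpow (logWeight_pos η).le h4 hp.le)
          (sourceSymbol_pos p η).le
      · rw [h3 hη, norm_zero]
        positivity
    rw [hw, Real.mul_rpow (by norm_num) hD0.le] at h1
    have hDp := Real.rpow_pos_of_pos hD0 p
    have h2p : (0 : ℝ) < 2 ^ p := by positivity
    change (2 ^ p)⁻¹ * ρ * D ^ (-p) ≤ _
    rw [Real.rpow_neg hD0.le, ← div_eq_mul_inv, div_le_iff₀ hDp, inv_mul_le_iff₀ h2p]
    linarith

/-- For the data `0` both `w` and `-w` are admissible. Their solutions are `2‖f‖` apart, so `R 0`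
misses one of them by at least `‖f‖`. -/
theorem exists_lower_bound {p : ℝ} (hp : 0 < p) {ρ : ℝ} (hρ : 0 < ρ) :
    ∀ᶠ δ in 𝓝[>] (0 : ℝ), ∀ R : L2pos → L2pos, ∃ w : L2pos, ‖w‖ = ρ ∧
      ‖laplaceOp (logSourceOp p w) - 0‖ ≤ δ ∧
      (2 ^ p)⁻¹ * ρ * logFun p (δ ^ 2 / ρ ^ 2) ≤ ‖logSourceOp p w - R 0‖ := by
  have hlim : Tendsto (fun δ : ℝ => -Real.log (δ ^ 2 / ρ ^ 2)) (𝓝[>] 0) atTop := by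
    have h1 : Tendsto (fun x : ℝ => 2 * -Real.log x) (𝓝[>] 0) atTop :=
      (tendsto_neg_atBot_atTop.comp Real.tendsto_log_nhdsGT_zero).const_mul_atTop two_pos
    refine (h1.comp (tendsto_div_nhdsGT hρ)).congr fun δ => ?_
    rw [← div_pow, Real.log_pow]
    simp
  filter_upwards [hlim.eventually_ge_atTop (1 + 4 * Real.pi ^ 2), self_mem_nhdsWithin]
    with δ hD hδ R
  obtain ⟨w, h1, h2, h3⟩ := exists_bad_source hp hρ hδ hD
  have h4 : 2 * ‖logSourceOp p w‖ ≤ ‖logSourceOp p w - R 0‖ + ‖-logSourceOp p w - R 0‖ := by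
    have e : (2 : ℝ) * ‖logSourceOp p w‖ =
        ‖(logSourceOp p w - R 0) - (-logSourceOp p w - R 0)‖ := by
      have : (logSourceOp p w - R 0) - (-logSourceOp p w - R 0) = (2 : ℂ) • logSourceOp p w := by
        rw [two_smul]
        abel
      rw [this, norm_smul]
      simp
    rw [e]
    exact norm_sub_le _ _
  rcases le_total ‖logSourceOp p w‖ ‖logSourceOp p w - R 0‖ with h | h
  · exact ⟨w, h1, by rwa [sub_zero], h3.trans h⟩
  · refine ⟨-w, by rwa [norm_neg], by rwa [sub_zero, map_neg, map_neg, norm_neg], ?_⟩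
    rw [map_neg]
    linarith

end RealLaplace

end

theorem mainTheorem2 (φ : ℝ → ℝ) (s p : ℝ) (hs : 0 < s) (hp : 0 < p)
    (hφ : RealLaplace.IsMollifier φ s) :
    -- for every parameter `β > 0` and all data, the mollified solution exists and is unique
    (∀ β : ℝ, 0 < β → ∀ γ : RealLaplace.L2pos,
      ∃! h : RealLaplace.L2pos, RealLaplace.IsMollifiedSolution hφ.integrable β γ h) ∧
    -- `V f ∈ H^p` yields the source element `w`, with equivalent norms
    (∃ C₁ C₂ : ℝ, 0 < C₁ ∧ 0 < C₂ ∧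
      ∀ f : RealLaplace.L2pos, RealLaplace.MemHp p (RealLaplace.vTransform f) →
        (∃! w : RealLaplace.L2pos, f = RealLaplace.logSourceOp p w) ∧
        ∀ w : RealLaplace.L2pos, f = RealLaplace.logSourceOp p w →
          C₁ * ‖w‖ ≤ RealLaplace.hpNorm p (RealLaplace.vTransform f) ∧
          RealLaplace.hpNorm p (RealLaplace.vTransform f) ≤ C₂ * ‖w‖) ∧
    -- the error bound, with `K` independent of `ρ` and `δ`
    (∃ K : ℝ, 0 < K ∧ ∀ ρ : ℝ, 0 < ρ →
      ∃ η : ℝ → ℝ, Tendsto η (𝓝[>] 0) (𝓝 0) ∧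
        ∀ᶠ δ in 𝓝[>] (0 : ℝ), ∀ f w g gδ h : RealLaplace.L2pos,
          RealLaplace.MemHp p (RealLaplace.vTransform f) →
          f = RealLaplace.logSourceOp p w → ‖w‖ = ρ →
          g = RealLaplace.laplaceOp f → ‖g - gδ‖ ≤ δ →
          RealLaplace.IsMollifiedSolution hφ.integrable (RealLaplace.betaRule p s ρ δ) gδ h →
            ‖f - h‖ ≤ K * ρ * RealLaplace.logFun p (δ ^ 2 / ρ ^ 2) * (1 + η δ)) ∧
    -- no reconstruction method `R` has a worst-case error of smaller order
    (∃ c : ℝ, 0 < c ∧ ∀ ρ : ℝ, 0 < ρ →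
      ∀ᶠ δ in 𝓝[>] (0 : ℝ), ∀ R : RealLaplace.L2pos → RealLaplace.L2pos,
        ∃ f w gδ : RealLaplace.L2pos,
          RealLaplace.MemHp p (RealLaplace.vTransform f) ∧
          f = RealLaplace.logSourceOp p w ∧ ‖w‖ = ρ ∧
          ‖RealLaplace.laplaceOp f - gδ‖ ≤ δ ∧
          c * ρ * RealLaplace.logFun p (δ ^ 2 / ρ ^ 2) ≤ ‖f - R gδ‖) := by
  refine ⟨fun β hβ γ => hφ.existsUnique_mollifiedSolution hβ γ,
    ⟨(5 ^ p)⁻¹, 2 ^ p, by positivity, by positivity, fun f hf => ⟨?_, ?_⟩⟩, ?_, ?_⟩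
  · obtain ⟨w, hw⟩ := RealLaplace.exists_source hp hf
    exact ⟨w, hw, fun w' hw' => RealLaplace.logSourceOp_injective hp (hw'.symm.trans hw)⟩
  · rintro w rfl
    exact RealLaplace.hpNorm_source_bounds hp w
  · obtain ⟨K, hK, h⟩ := hφ.exists_rate hs hp
    -- For all small `δ` the bound holds without any correction, so the `o(1)` term can be taken to
    -- be zero.
    refine ⟨K, hK, fun ρ hρ => ⟨fun _ => 0, tendsto_const_nhds, ?_⟩⟩
    filter_upwards [h ρ hρ] with δ hδ
    rintro f w g gδ u - rfl hw rfl hg hu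
    rw [add_zero, mul_one]
    exact hδ w gδ u hw hg hu
  · refine ⟨(2 ^ p)⁻¹, by positivity, fun ρ hρ => ?_⟩
    filter_upwards [RealLaplace.exists_lower_bound hp hρ] with δ hδ R
    obtain ⟨w, h1, h2, h3⟩ := hδ R
    exact ⟨_, w, 0, RealLaplace.memHp_source hp w, rfl, h1, h2, h3⟩
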